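/- Let $\Omega=(0,1)$, $T>0$ and $Q_T=\Omega\times(0,T)$. Let $H^1_{(0)}(\Omega)=\{z\in H^1(\Omega):z(0)=0\}$, with norm $\|z\|_{H^1_{(0)}(\Omega)}=\|\partial_x z\|_{L^2(\Omega)}$, and let $H^{-1}_{(0)}(\Omega)$ be its dual, with the dual norm; $L^2(\Omega)$ is embedded in $H^{-1}_{(0)}(\Omega)$ by $\langle f,z\rangle=\int_\Omega fz\,dx$. For $A\in L^\infty(Q_T)$ and $(\varphi_0,\varphi_1)\in L^2(\Omega)\times H^{-1}_{(0)}(\Omega)$ consider $$\partial_{tt}\varphi-\partial_{xx}\varphi+A\varphi=0\ \text{ in }Q_T,\qquad \varphi(0,t)=0,\ \ \partial_x\varphi(1,t)=0\ \text{ on }(0,T),\qquad (\varphi,\partial_t\varphi)(\cdot,0)=(\varphi_0,\varphi_1)\ \text{ in }\Omega. \qquad(\star)$$ For $g\in L^2(Q_T)$, a weak solution of the backward problem $$\partial_{tt}w-\partial_{xx}w+Aw=g\ \text{ in }Q_T,\qquad w(0,\cdot)=0,\ \ \partial_x w(1,\cdot)=0\ \text{ on }(0,T),\qquad (w,\partial_t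 w)(\cdot,T)=(0,0)$$ is a function $w\in C^0([0,T];H^1_{(0)}(\Omega))\cap C^1([0,T];L^2(\Omega))\cap H^2(0,T;H^{-1}_{(0)}(\Omega))$ with $(w,\partial_tw)(\cdot,T)=(0,0)$ such that, for a.e. $t\in(0,T)$, $$\langle\partial_{tt}w(\cdot,t),z\rangle_{H^{-1}_{(0)}(\Omega),H^1_{(0)}(\Omega)}+\int_\Omega\partial_xw\,\partial_xz\,dx+\int_\Omega Awz\,dx=\int_\Omega gz\,dx\qquad\forall z\in H^1_{(0)}(\Omega).$$ A solution of $(\star)$ in the sense of transposition is a function $\varphi\in L^2(Q_T)$ such that, for every $g\in L^2(Q_T)$, $$\int_{Q_T}\varphi g\,dx\,dt=\langle\varphi_1,w(\cdot,0)\rangle_{H^{-1}_{(0)}(\Omega),H^1_{(0)}(\Omega)}-\int_\Omega\varphi_0\,\partial_tw(\cdot,0)\,dx,$$ where $w$ is the weak solution of the backward problem with right-hand side $g$. Theorem. For every $T>0$ there is a constant $C=C(T)>0$ such that, for every $A\in L^\infty(Q_T)$ and every $(\varphi_0,\varphi_1)\in L^2(\Omega)\times H^{-1}_{(0)}(\Omega)$,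 problem $(\star)$ has a unique solution $\varphi$ in the sense of transposition; this solution belongs to $C^0([0,T];L^2(\Omega))\cap C^1([0,T];H^{-1}_{(0)}(\Omega))$, and for every $t\in[0,T]$ $$\|\varphi(\cdot,t)\|_{L^2(\Omega)}+\|\partial_t\varphi(\cdot,t)\|_{H^{-1}_{(0)}(\Omega)}\le C e^{C\sqrt{\|A\|_{L^\infty(Q_T)}}}\,\|(\varphi_0,\varphi_1)\|_{L^2(\Omega)\times H^{-1}_{(0)}(\Omega)},$$ where $\|(\varphi_0,\varphi_1)\|^2_{L^2(\Omega)\times H^{-1}_{(0)}(\Omega)}=\|\varphi_0\|^2_{L^2(\Omega)}+\|\varphi_1\|^2_{H^{-1}_{(0)}(\Omega)}$. -/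

import Mathlib

open MeasureTheory Set

open scoped ContDiff ENNReal

noncomputable section

namespace WaveTransposition

/-! ### Lebesgue spaces on `Ω = (0,1)` and `Q_T = Ω × (0,T)` -/

/-- Lebesgue measure on `Ω = (0,1)`. -/
abbrev volΩ : Measure ℝ := volume.restrict (Ioo (0 : ℝ) 1)

/-- Lebesgue measure on the time interval `(0,T)`. -/
abbrev volTime (T : ℝ) : Measure ℝ := volume.restrict (Ioo (0 : ℝ) T)

/-- Lebesgue measure on `Q_T = Ω × (0,T)`; points are written `(x, t)`. -/
abbrev volQ (T : ℝ) : Measure (ℝ × ℝ) := volΩ.prod (volTime T)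

/-- `L²(Ω)`. -/
abbrev L2Ω : Type := Lp ℝ 2 volΩ

/-- `L²(Q_T) = L²(0,T; L²(Ω))`. -/
abbrev L2Q (T : ℝ) : Type := Lp ℝ 2 (volQ T)

/-- `L^∞(Q_T)`. -/
abbrev LinftyQ (T : ℝ) : Type := Lp ℝ ∞ (volQ T)

instance : IsProbabilityMeasure volΩ :=
  ⟨by simp [volΩ]⟩

/-! ### Weak derivatives -/

/-- `η ∈ C_c^∞((a,b))`. -/
def IsTestFunction (a b : ℝ) (η : ℝ → ℝ) : Prop :=
  ContDiff ℝ ∞ η ∧ HasCompactSupport η ∧ tsupport η ⊆ Ioo a b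

/-- `v` is the weak (distributional) derivative of `u` on `(a,b)`, for functions with values in a
Banach space (used with integrable `u` and `v`). -/
def HasWeakDeriv {X : Type*} [NormedAddCommGroup X] [NormedSpace ℝ X] (a b : ℝ) (u v : ℝ → X) :
    Prop :=
  ∀ η : ℝ → ℝ, IsTestFunction a b η →
    ∫ s in Ioo a b, deriv η s • u s = -∫ s in Ioo a b, η s • v s

theorem IsTestFunction.integrable_smul {η : ℝ → ℝ} (hη : IsTestFunction 0 1 η) (f : L2Ω) :
    Integrable (fun s => η s • f s) volΩ := by
  have hf : Integrable (f : ℝ → ℝ) volΩ := (Lp.memLp f).integrable one_le_two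
  obtain ⟨C, hC⟩ := hη.2.1.exists_bound_of_continuous hη.1.continuous
  exact hf.bdd_smul C hη.1.continuous.aestronglyMeasurable (Filter.Eventually.of_forall hC)

theorem IsTestFunction.integrable_deriv_smul {η : ℝ → ℝ} (hη : IsTestFunction 0 1 η)
    (f : L2Ω) : Integrable (fun s => deriv η s • f s) volΩ := by
  have hf : Integrable (f : ℝ → ℝ) volΩ := (Lp.memLp f).integrable one_le_two
  have hc : Continuous (deriv η) := (contDiff_infty_iff_deriv.mp hη.1).2.continuous
  obtain ⟨C, hC⟩ := hη.2.1.deriv.exists_bound_of_continuous hc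
  exact hf.bdd_smul C hc.aestronglyMeasurable (Filter.Eventually.of_forall hC)

/-! ### The space `H¹_{(0)}(Ω)` -/

/-- The graph `{(z, ∂ₓz) : z ∈ H¹(Ω), z(0) = 0}`. The second component is the weak derivative of
the first, and the value at `0` is that of the continuous representative. -/
def H10Graph : Submodule ℝ (L2Ω × L2Ω) where
  carrier := {p | HasWeakDeriv 0 1 p.1 p.2 ∧
    ∃ u : ℝ → ℝ, ContinuousOn u (Icc 0 1) ∧ p.1 =ᵐ[volΩ] u ∧ u 0 = 0}
  zero_mem' := by
    refine ⟨fun η _ => ?_, 0, continuousOn_const, Lp.coeFn_zero ℝ 2 volΩ, rfl⟩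
    have h0 := Lp.coeFn_zero ℝ 2 volΩ
    rw [integral_congr_ae (g := 0), integral_congr_ae (g := 0)]
    · simp
    · filter_upwards [h0] with s _
      simp
    · filter_upwards [h0] with s _
      simp
  add_mem' := by
    rintro p q ⟨hp, u, hu, hpu, hu0⟩ ⟨hq, v, hv, hqv, hv0⟩
    refine ⟨fun η hη => ?_, u + v, hu.add hv, (Lp.coeFn_add p.1 q.1).trans (hpu.add hqv), by
      simp [hu0, hv0]⟩
    have e1 : ∫ s in Ioo (0 : ℝ) 1, deriv η s • (p + q).1 s
        = ∫ s in Ioo (0 : ℝ) 1, (deriv η s • p.1 s + deriv η s • q.1 s) := by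
      refine integral_congr_ae ?_
      filter_upwards [Lp.coeFn_add p.1 q.1] with s hs
      rw [Prod.fst_add, hs, Pi.add_apply, smul_add]
    have e2 : ∫ s in Ioo (0 : ℝ) 1, η s • (p + q).2 s
        = ∫ s in Ioo (0 : ℝ) 1, (η s • p.2 s + η s • q.2 s) := by
      refine integral_congr_ae ?_
      filter_upwards [Lp.coeFn_add p.2 q.2] with s hs
      rw [Prod.snd_add, hs, Pi.add_apply, smul_add]
    rw [e1, e2, integral_add (hη.integrable_deriv_smul _) (hη.integrable_deriv_smul _),
      integral_add (hη.integrable_smul _) (hη.integrable_smul _), hp η hη, hq η hη]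
    ring
  smul_mem' := by
    rintro c p ⟨hp, u, hu, hpu, hu0⟩
    refine ⟨fun η hη => ?_, c • u, hu.const_smul c,
      (Lp.coeFn_smul c p.1).trans (hpu.const_smul c), by simp [hu0]⟩
    have e1 : ∫ s in Ioo (0 : ℝ) 1, deriv η s • (c • p).1 s
        = ∫ s in Ioo (0 : ℝ) 1, c • (deriv η s • p.1 s) := by
      refine integral_congr_ae ?_
      filter_upwards [Lp.coeFn_smul c p.1] with s hs
      rw [Prod.smul_fst, hs, Pi.smul_apply, smul_comm]
    have e2 : ∫ s in Ioo (0 : ℝ) 1, η s • (c • p).2 s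
        = ∫ s in Ioo (0 : ℝ) 1, c • (η s • p.2 s) := by
      refine integral_congr_ae ?_
      filter_upwards [Lp.coeFn_smul c p.2] with s hs
      rw [Prod.smul_snd, hs, Pi.smul_apply, smul_comm]
    rw [e1, e2, integral_smul, integral_smul, hp η hη, smul_neg]

/-- `H¹_{(0)}(Ω) = {z ∈ H¹(Ω) : z(0) = 0}`. -/
def H10 : Type := ↥H10Graph

instance : AddCommGroup H10 := inferInstanceAs (AddCommGroup ↥H10Graph)

instance : Module ℝ H10 := inferInstanceAs (Module ℝ ↥H10Graph)

/-- The inclusion `H¹_{(0)}(Ω) → L²(Ω)`, as a linear map. -/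
def H10.toL2 : H10 →ₗ[ℝ] L2Ω := (LinearMap.fst ℝ L2Ω L2Ω).comp H10Graph.subtype

/-- The weak derivative `∂ₓ : H¹_{(0)}(Ω) → L²(Ω)`, as a linear map. -/
def H10.dx : H10 →ₗ[ℝ] L2Ω := (LinearMap.snd ℝ L2Ω L2Ω).comp H10Graph.subtype

/-- A function whose weak derivative vanishes is almost everywhere constant. -/
theorem ae_eq_const_of_weakDeriv_zero {f : ℝ → ℝ} (hf : IntegrableOn f (Ioo 0 1))
    (h : ∀ η : ℝ → ℝ, IsTestFunction 0 1 η → ∫ s in Ioo (0 : ℝ) 1, deriv η s * f s = 0) :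
    ∃ k : ℝ, ∀ᵐ x ∂volΩ, f x = k := by
  let χb : ContDiffBump (1 / 2 : ℝ) := ⟨1 / 8, 1 / 4, by norm_num, by norm_num⟩
  set χ : ℝ → ℝ := χb.normed volume with hχ
  have χsm : ContDiff ℝ ∞ χ := χb.contDiff_normed
  have χcs : HasCompactSupport χ := χb.hasCompactSupport_normed
  have χts : tsupport χ ⊆ Ioo 0 1 := by
    rw [hχ, χb.tsupport_normed_eq]
    intro x hx
    rw [Real.closedBall_eq_Icc] at hx
    have h1 : (1 / 2 : ℝ) - 1 / 4 ≤ x := hx.1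
    have h2 : x ≤ (1 / 2 : ℝ) + 1 / 4 := hx.2
    constructor <;> linarith
  have χint : ∫ x, χ x = 1 := χb.integral_normed
  have mulInt : ∀ g : ℝ → ℝ, ContDiff ℝ ∞ g → HasCompactSupport g →
      Integrable (fun s => g s * f s) volΩ := fun g hg hgc => by
    obtain ⟨C, hC⟩ := hgc.exists_bound_of_continuous hg.continuous
    exact Integrable.bdd_mul (c := C) hf hg.continuous.aestronglyMeasurable
      (Filter.Eventually.of_forall hC)
  refine ⟨∫ s in Ioo (0 : ℝ) 1, χ s * f s, ?_⟩
  set k := ∫ s in Ioo (0 : ℝ) 1, χ s * f s with hk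
  have key := isOpen_Ioo.ae_eq_zero_of_integral_contDiff_smul_eq_zero
    (U := Ioo (0 : ℝ) 1) (f := fun x => f x - k) (μ := volume)
    ((hf.sub (integrable_const k)).locallyIntegrableOn) ?_
  · rw [ae_restrict_iff' measurableSet_Ioo]
    filter_upwards [key] with x hx hx1
    linarith [hx hx1]
  intro ψ ψsm ψcs ψts
  set c := ∫ x, ψ x with hc
  let q : ℝ → ℝ := fun x => ψ x - c * χ x
  have qsm : ContDiff ℝ ∞ q := ψsm.sub (contDiff_const.mul χsm)
  have qc : Continuous q := qsm.continuous
  have ψi : Integrable ψ := ψsm.continuous.integrable_of_hasCompactSupport ψcs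
  have χi : Integrable χ := χsm.continuous.integrable_of_hasCompactSupport χcs
  have qint : ∫ x, q x = 0 := by
    simp only [q]
    rw [integral_sub ψi (χi.const_mul c), integral_const_mul, χint, ← hc]
    ring
  have qi : Integrable q := ψi.sub (χi.const_mul c)
  -- a compact interval containing the supports
  have hK : IsCompact (tsupport ψ ∪ tsupport χ ∪ {1 / 2}) :=
    (ψcs.isCompact.union χcs.isCompact).union isCompact_singleton
  have hKsub : tsupport ψ ∪ tsupport χ ∪ {1 / 2} ⊆ Ioo (0 : ℝ) 1 := by
    refine union_subset (union_subset ψts χts) ?_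
    rintro x rfl
    constructor <;> norm_num
  have hKne : (tsupport ψ ∪ tsupport χ ∪ {(1 / 2 : ℝ)}).Nonempty := ⟨1 / 2, by simp⟩
  obtain ⟨a, haK, ha⟩ := hK.exists_isLeast hKne
  obtain ⟨b, hbK, hb⟩ := hK.exists_isGreatest hKne
  have ha0 : 0 < a := (hKsub haK).1
  have hb1 : b < 1 := (hKsub hbK).2
  have qout : ∀ x, x ∉ Icc a b → q x = 0 := by
    intro x hx
    have hxK : x ∉ tsupport ψ ∪ tsupport χ ∪ {(1 / 2 : ℝ)} := fun hxK => hx ⟨ha hxK, hb hxK⟩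
    have h1 : ψ x = 0 := image_eq_zero_of_notMem_tsupport fun h' => hxK (Or.inl (Or.inl h'))
    have h2 : χ x = 0 := image_eq_zero_of_notMem_tsupport fun h' => hxK (Or.inl (Or.inr h'))
    simp [q, h1, h2]
  let η : ℝ → ℝ := fun x => ∫ y in (0 : ℝ)..x, q y
  have ηd : ∀ x, HasDerivAt η (q x) x := fun x =>
    intervalIntegral.integral_hasDerivAt_right (qc.intervalIntegrable _ _)
      (qc.stronglyMeasurableAtFilter _ _) qc.continuousAt
  have ηd' : deriv η = q := funext fun x => (ηd x).deriv
  have ηout : ∀ x, x ∉ Icc a b → η x = 0 := by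
    intro x hx
    have hcase : x < a ∨ b < x := by
      by_contra! hcon
      exact hx ⟨hcon.1, hcon.2⟩
    rcases hcase with hxa | hxb
    · have : ∫ y in (0 : ℝ)..x, q y = ∫ y in (0 : ℝ)..x, (0 : ℝ) := by
        refine intervalIntegral.integral_congr fun y hy => qout y fun hy' => ?_
        have : y ≤ max 0 x := hy.2
        have h3 : max 0 x < a := max_lt ha0 hxa
        linarith [hy'.1]
      simpa [η] using this
    · have hsupp : Function.support q ⊆ Ioc 0 x := by
        intro y hy
        by_contra hy2
        refine hy (qout y fun hy' => hy2 ⟨by linarith [hy'.1], by linarith [hy'.2]⟩)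
      have := intervalIntegral.integral_eq_integral_of_support_subset (μ := volume) hsupp
      simp only [η]
      rw [this, qint]
  have ηts : tsupport η ⊆ Icc a b := by
    refine closure_minimal (fun x hx => ?_) isClosed_Icc
    by_contra hx2
    exact hx (ηout x hx2)
  have ηtest : IsTestFunction 0 1 η := by
    refine ⟨contDiff_infty_iff_deriv.mpr ⟨fun x => (ηd x).differentiableAt, ηd' ▸ qsm⟩,
      isCompact_Icc.of_isClosed_subset (isClosed_tsupport η) ηts, ηts.trans fun x hx => ?_⟩
    exact ⟨by linarith [hx.1], by linarith [hx.2]⟩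
  have h0 := h η ηtest
  rw [ηd'] at h0
  have ψf := mulInt ψ ψsm ψcs
  have χf := mulInt χ χsm χcs
  have h1 : ∫ s in Ioo (0 : ℝ) 1, ψ s * f s = c * k := by
    have : ∫ s in Ioo (0 : ℝ) 1, q s * f s
        = (∫ s in Ioo (0 : ℝ) 1, ψ s * f s) - c * k := by
      rw [hk, ← integral_const_mul, ← integral_sub ψf (χf.const_mul c)]
      refine integral_congr_ae (Filter.Eventually.of_forall fun s => ?_)
      simp only [q]
      ring
    linarith
  have h2 : ∫ s in Ioo (0 : ℝ) 1, ψ s = c := by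
    rw [hc]
    refine setIntegral_eq_integral_of_forall_compl_eq_zero fun x hx => ?_
    exact image_eq_zero_of_notMem_tsupport fun h' => hx (ψts h')
  have h3 : ∫ x, ψ x • (f x - k) = ∫ x in Ioo (0 : ℝ) 1, ψ x • (f x - k) := by
    refine (setIntegral_eq_integral_of_forall_compl_eq_zero fun x hx => ?_).symm
    rw [image_eq_zero_of_notMem_tsupport fun h' => hx (ψts h'), zero_smul]
  have h4 : ∫ x in Ioo (0 : ℝ) 1, ψ x • (f x - k)
      = (∫ s in Ioo (0 : ℝ) 1, ψ s * f s) - (∫ s in Ioo (0 : ℝ) 1, ψ s) * k := by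
    rw [← integral_mul_const, ← integral_sub ψf (ψi.restrict.mul_const k)]
    refine integral_congr_ae (Filter.Eventually.of_forall fun s => ?_)
    simp only [smul_eq_mul]
    ring
  rw [h3, h4, h1, h2, sub_self]

/-- An element of `H¹_{(0)}(Ω)` is the primitive of its weak derivative vanishing at `0`. -/
theorem H10.ae_eq_primitive (z : H10) :
    ∀ᵐ x ∂volΩ, z.toL2 x = ∫ y in (0 : ℝ)..x, z.dx y := by
  obtain ⟨⟨z, d⟩, hw, u, hu, hzu, hu0⟩ := z
  change ∀ᵐ x ∂volΩ, z x = ∫ y in (0 : ℝ)..x, d y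
  change z =ᵐ[volΩ] u at hzu
  change HasWeakDeriv 0 1 z d at hw
  have zi : IntegrableOn z (Ioo 0 1) := (Lp.memLp z).integrable one_le_two
  have di : IntegrableOn d (Ioo 0 1) := (Lp.memLp d).integrable one_le_two
  have di' : IntervalIntegrable d volume 0 1 := by
    rw [intervalIntegrable_iff_integrableOn_Ioo_of_le zero_le_one]
    exact di
  set v : ℝ → ℝ := fun x => ∫ y in (0 : ℝ)..x, d y with hv
  have vac : AbsolutelyContinuousOnInterval v 0 1 :=
    di'.absolutelyContinuousOnInterval_intervalIntegral (by simp)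
  have vc : ContinuousOn v (Icc 0 1) := by
    have := vac.continuousOn
    rwa [uIcc_of_le zero_le_one] at this
  have vi : IntegrableOn v (Ioo 0 1) :=
    (vc.integrableOn_compact isCompact_Icc).mono_set Ioo_subset_Icc_self
  have toIoo : ∀ F : ℝ → ℝ, ∫ x in (0 : ℝ)..1, F x = ∫ x in Ioo (0 : ℝ) 1, F x := fun F => by
    rw [intervalIntegral.integral_of_le zero_le_one, integral_Ioc_eq_integral_Ioo]
  obtain ⟨k, hk⟩ := ae_eq_const_of_weakDeriv_zero (f := fun x => z x - v x) (zi.sub vi) (by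
    intro η hη
    have hηd : ContDiff ℝ ∞ (deriv η) := (contDiff_infty_iff_deriv.mp hη.1).2
    have ηac : AbsolutelyContinuousOnInterval η 0 1 :=
      (hη.1.of_le (by simp)).contDiffOn.absolutelyContinuousOnInterval
    have η0 : η 0 = 0 := image_eq_zero_of_notMem_tsupport fun h' => by simpa using hη.2.2 h'
    have η1 : η 1 = 0 := image_eq_zero_of_notMem_tsupport fun h' => by simpa using hη.2.2 h'
    have ibp := vac.integral_mul_deriv_eq_deriv_mul ηac
    have hdv : ∫ x in (0 : ℝ)..1, deriv v x * η x = ∫ x in (0 : ℝ)..1, d x * η x := by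
      refine intervalIntegral.integral_congr_ae ?_
      filter_upwards [di'.ae_hasDerivAt_integral] with x hx hx1
      rw [(hx (uIoc_subset_uIcc hx1) 0 (by simp)).deriv]
    rw [η0, η1, hdv, toIoo, toIoo] at ibp
    have hwη := hw η hη
    have hz : Integrable (fun s => deriv η s * z s) volΩ := hη.integrable_deriv_smul z
    have hvη : Integrable (fun s => deriv η s * v s) volΩ := by
      obtain ⟨C, hC⟩ := hη.2.1.deriv.exists_bound_of_continuous hηd.continuous
      exact Integrable.bdd_mul (c := C) vi hηd.continuous.aestronglyMeasurable
        (Filter.Eventually.of_forall hC)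
    simp only [mul_sub]
    rw [integral_sub hz hvη]
    simp only [smul_eq_mul] at hwη
    have c1 : ∫ x in Ioo (0 : ℝ) 1, v x * deriv η x
        = ∫ x in Ioo (0 : ℝ) 1, deriv η x * v x := by simp only [mul_comm]
    have c2 : ∫ x in Ioo (0 : ℝ) 1, d x * η x = ∫ x in Ioo (0 : ℝ) 1, η x * d x := by
      simp only [mul_comm]
    rw [hwη, ← c1, ibp, c2]
    ring)
  -- the continuous representative minus the primitive is constant, equal to its value at `0`
  have hEq : (fun x => u x - v x) =ᵐ[volΩ] fun _ => k := by
    filter_upwards [hk, hzu] with x h1 h2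
    rw [← h2, h1]
  have hEq2 : EqOn (fun x => u x - v x) (fun _ => k) (Ioo 0 1) :=
    Measure.eqOn_open_of_ae_eq hEq isOpen_Ioo
      ((hu.sub vc).mono Ioo_subset_Icc_self) continuousOn_const
  have hk0 : k = 0 := by
    have hcl : EqOn (fun x => u x - v x) (fun _ => k) (Icc 0 1) :=
      hEq2.of_subset_closure (hu.sub vc) continuousOn_const Ioo_subset_Icc_self
        (by rw [closure_Ioo (by norm_num)])
    have := hcl (left_mem_Icc.mpr zero_le_one)
    simpa [hu0, hv] using this.symm
  filter_upwards [hk] with x hx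
  have : z x - v x = 0 := by rw [hx, hk0]
  linarith

/-- Poincaré's inequality on `H¹_{(0)}(Ω)`. -/
theorem H10.norm_toL2_le (z : H10) : ‖z.toL2‖ ≤ ‖z.dx‖ := by
  have hb : ∀ᵐ x ∂volΩ, ‖z.toL2 x‖ ≤ ‖z.dx‖ := by
    have di : Integrable z.dx volΩ := (Lp.memLp z.dx).integrable one_le_two
    have h1 : ∫ x, ‖z.dx x‖ ∂volΩ ≤ ‖z.dx‖ := by
      rw [integral_norm_eq_lintegral_enorm di.aestronglyMeasurable, Lp.norm_def,
        ← eLpNorm_one_eq_lintegral_enorm]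
      exact ENNReal.toReal_mono (Lp.eLpNorm_ne_top _)
        (eLpNorm_le_eLpNorm_of_exponent_le one_le_two di.aestronglyMeasurable)
    have hmem : ∀ᵐ x ∂volΩ, x ∈ Ioo (0 : ℝ) 1 := ae_restrict_mem measurableSet_Ioo
    filter_upwards [z.ae_eq_primitive, hmem] with x hx hx1
    rw [hx, intervalIntegral.integral_of_le hx1.1.le]
    refine (norm_integral_le_integral_norm _).trans (le_trans ?_ h1)
    refine setIntegral_mono_set di.norm (Filter.Eventually.of_forall fun _ => norm_nonneg _) ?_
    exact Filter.Eventually.of_forall fun y hy => ⟨hy.1, hy.2.trans_lt hx1.2⟩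
  have h1 : measureUnivNNReal volΩ = 1 := by simp [measureUnivNNReal]
  have := Lp.norm_le_of_ae_bound (norm_nonneg z.dx) hb
  simpa [h1] using this

theorem H10.dx_injective : Function.Injective H10.dx := by
  rw [injective_iff_map_eq_zero]
  intro z hz
  have h1 : H10.toL2 z = 0 := by
    have := z.norm_toL2_le
    rw [hz, norm_zero] at this
    exact norm_le_zero_iff.mp this
  exact Subtype.ext (Prod.ext h1 hz)

/-- `H¹_{(0)}(Ω)` carries the norm `‖z‖ = ‖∂ₓ z‖_{L²(Ω)}`. -/
instance : NormedAddCommGroup H10 :=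
  NormedAddCommGroup.induced H10 L2Ω H10.dx H10.dx_injective

instance : NormedSpace ℝ H10 := NormedSpace.induced ℝ H10 L2Ω H10.dx

theorem H10.norm_def (z : H10) : ‖z‖ = ‖z.dx‖ := rfl

/-- `H^{-1}_{(0)}(Ω)`, the dual of `H¹_{(0)}(Ω)`, with the dual norm. -/
abbrev Hm1 : Type := H10 →L[ℝ] ℝ

/-- The continuous inclusion `H¹_{(0)}(Ω) → L²(Ω)`. -/
def H10.inclL2 : H10 →L[ℝ] L2Ω :=
  H10.toL2.mkContinuous 1 fun z => by
    rw [one_mul]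
    exact z.norm_toL2_le

/-- The inclusion `L²(Ω) → H^{-1}_{(0)}(Ω)`, `⟨f, z⟩ = ∫_Ω f z dx`. -/
def L2Ω.toHm1 (f : L2Ω) : Hm1 := (innerSL ℝ f).comp H10.inclL2

/-! ### The backward adjoint problem -/

/-- `w ∈ C⁰([0,T]; H¹_{(0)}(Ω)) ∩ C¹([0,T]; L²(Ω))`, with time derivative `wt`, is a weak solution
of `∂ₜₜ w - ∂ₓₓ w + A w = g` in `Q_T`, `w(0,·) = 0`, `∂ₓ w(1,·) = 0`,
`(w(·,T), ∂ₜ w(·,T)) = (0,0)`. Only the values on `[0,T]` matter. The second time derivative `wtt`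
is the weak derivative of `wt` in `L²(0,T; H^{-1}_{(0)}(Ω))`. -/
structure IsBackwardWeakSolution (T : ℝ) (A : LinftyQ T) (g : L2Q T)
    (w : ℝ → H10) (wt : ℝ → L2Ω) : Prop where
  continuousOn : ContinuousOn w (Icc 0 T)
  continuousOn_deriv : ContinuousOn wt (Icc 0 T)
  hasDerivWithinAt : ∀ t ∈ Icc 0 T,
    HasDerivWithinAt (fun s => H10.inclL2 (w s)) (wt t) (Icc 0 T) t
  variational : ∃ wtt : ℝ → Hm1, MemLp wtt 2 (volTime T) ∧
    HasWeakDeriv 0 T (fun t => L2Ω.toHm1 (wt t)) wtt ∧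
    ∀ᵐ t ∂volTime T, ∀ z : H10,
      wtt t z + (∫ x, (w t).dx x * z.dx x ∂volΩ)
          + (∫ x, A (x, t) * (w t).toL2 x * z.toL2 x ∂volΩ)
        = ∫ x, g (x, t) * z.toL2 x ∂volΩ
  final : w T = 0
  final_deriv : wt T = 0

/-! ### Solutions in the sense of transposition -/

/-- `φ ∈ L²(0,T; L²(Ω))` is a solution in the sense of transposition of
`∂ₜₜ φ - ∂ₓₓ φ + A φ = B` in `Q_T`, `φ(0,·) = 0`, `∂ₓ φ(1,·) = 0`,
`(φ(·,0), ∂ₜ φ(·,0)) = (φ₀, φ₁)`. -/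
def IsTranspositionSolution (T : ℝ) (A : LinftyQ T) (B : L2Q T) (φ₀ : L2Ω) (φ₁ : Hm1)
    (φ : L2Q T) : Prop :=
  ∀ (g : L2Q T) (w : ℝ → H10) (wt : ℝ → L2Ω), IsBackwardWeakSolution T A g w wt →
    ∫ p, φ p * g p ∂volQ T
      = (∫ t, ∫ x, B (x, t) * (w t).toL2 x ∂volΩ ∂volTime T)
        + φ₁ (w 0) - ∫ x, φ₀ x * wt 0 x ∂volΩ

/-- `φ ∈ C⁰([0,T]; L²(Ω)) ∩ C¹([0,T]; H^{-1}_{(0)}(Ω))`: `u t` and `ut t` are the values of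
`φ(·,t)` and `∂ₜφ(·,t)` for `t ∈ [0,T]`. -/
structure IsContinuousRepresentative (T : ℝ) (φ : L2Q T) (u : ℝ → L2Ω) (ut : ℝ → Hm1) :
    Prop where
  ae_eq : ∀ᵐ t ∂volTime T, ∀ᵐ x ∂volΩ, φ (x, t) = u t x
  continuousOn : ContinuousOn u (Icc 0 T)
  continuousOn_deriv : ContinuousOn ut (Icc 0 T)
  hasDerivWithinAt : ∀ t ∈ Icc 0 T,
    HasDerivWithinAt (fun s => L2Ω.toHm1 (u s)) (ut t) (Icc 0 T) t

end WaveTransposition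

end

/-! Let `J` be the primitive vanishing at `0` on `L²(Ω)` and `B (φ, r) = (-J r, J† φ)` on `L²(Ω) ×
L²(Ω)`. The operator `B` is bounded, skew-adjoint and injective, and its inverse is the free wave
generator. In first-order form the free equation reads `(B Y)' = Y`, so no unbounded operator ever
appears. The same system serves at two levels. A finite-energy solution `w` is encoded by `Y = (∂ₜw,
-∂ₓw)`, and `w` itself is `(B Y).fst`. A solution in `L² × H⁻¹` is encoded by `Y = (φ, r)`, where
`r` is the Riesz representative of `∂ₜφ`: under `rieszL`, which identifies `L²(Ω)` with `Hm1`, the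
embedding of `L²(Ω)` becomes `J†`. The strongly continuous group `U` of isometries generated by
`B⁻¹` is obtained in `IsSkew.exists_unitaryGroup` from bounded commuting approximations of `B⁻¹`.

The solution is constructed from the Duhamel equation `u = (U X).fst - D(A u)` with `X = (φ₀, r₀)`.
Here `D G` is the solution with zero data and source `G`. The Duhamel kernel at time lag `t - s` has
norm at most `t - s` (`norm_duhamel_le`), so the equation behaves like `y'' = ‖A‖ y` rather than `y'
= ‖A‖ y`. In the norm weighted by `exp (-2 √‖A‖ t)` the integral operator contracts by `1/4`. This
gives existence, and the growth rate `√‖A‖` in the estimate.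

Transposition is a duality statement. Let `F = g - A w` be the source of a backward solution once
the potential is moved to the right-hand side; then `w` is an explicit mild solution. The operator
`D` is adjoint to `F ↦ w`, and the isometries `U` turn `∫ ⟪F, (U X).fst⟫` into `-⟪X, Y(0)⟫`, which
is the right-hand side of the transposition identity. For uniqueness `F` is prescribed first and `g`
is defined as `F + A w`, so the backward problem with potential never has to be solved. The
difference `ψ` of two solutions is then orthogonal to every `F` after adding `D(A ψ)`, hence `ψ =
-D(A ψ)`, and the second-order Gronwall inequality gives `ψ = 0`. -/

noncomputable section

namespace WaveTransposition

open Filter Topology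
open scoped RealInnerProductSpace InnerProduct

/-! ### The unitary group generated by the inverse of a skew-adjoint operator -/

section SkewGroup

variable {E : Type*} [NormedAddCommGroup E] [InnerProductSpace ℝ E]

/-- `B` is skew-adjoint. -/
def IsSkew (B : E →L[ℝ] E) : Prop := ∀ x y, ⟪B x, y⟫ = -⟪x, B y⟫

theorem IsSkew.inner_self {B : E →L[ℝ] E} (hB : IsSkew B) (x : E) : ⟪B x, x⟫ = 0 := by
  have h := hB x x
  rw [real_inner_comm (B x) x] at h
  linarith

variable [CompleteSpace E]

/-- The orthogonal complement of the range is the kernel of the adjoint `-B`, hence trivial. -/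
theorem IsSkew.denseRange {B : E →L[ℝ] E} (hB : IsSkew B) (hinj : Function.Injective B) :
    DenseRange B := by
  have h : (LinearMap.range (B : E →ₗ[ℝ] E)).topologicalClosure = ⊤ := by
    rw [Submodule.topologicalClosure_eq_top_iff, Submodule.eq_bot_iff]
    intro x hx
    apply hinj
    rw [map_zero, ← inner_self_eq_zero (𝕜 := ℝ), hB, neg_eq_zero, real_inner_comm]
    exact hx _ ⟨B x, rfl⟩
  have h2 := (Submodule.dense_iff_topologicalClosure_eq_top).mpr h
  simpa only [DenseRange, LinearMap.coe_range, ContinuousLinearMap.coe_coe] using h2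

theorem hasDerivAt_exp_smul_apply (S : E →L[ℝ] E) (x : E) (t : ℝ) :
    HasDerivAt (fun s : ℝ => NormedSpace.exp (s • S) x) (NormedSpace.exp (t • S) (S x)) t := by
  have h := hasDerivAt_exp_smul_const (𝕂 := ℝ) S t
  exact ((ContinuousLinearMap.apply ℝ E x).hasFDerivAt.comp_hasDerivAt t h)

/-- The derivative of the squared norm along the flow is `2 ⟪y, S y⟫ = 0`. -/
theorem IsSkew.norm_exp_apply {S : E →L[ℝ] E} (hS : IsSkew S) (t : ℝ) (x : E) :
    ‖NormedSpace.exp (t • S) x‖ = ‖x‖ := by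
  have hd : ∀ s : ℝ, HasDerivAt (fun s : ℝ => ‖NormedSpace.exp (s • S) x‖ ^ 2) 0 s := by
    intro s
    have h1 := hasDerivAt_exp_smul_const' (𝕂 := ℝ) S s
    have h2 : HasDerivAt (fun s : ℝ => NormedSpace.exp (s • S) x)
        (S (NormedSpace.exp (s • S) x)) s :=
      (ContinuousLinearMap.apply ℝ E x).hasFDerivAt.comp_hasDerivAt s h1
    have h3 := h2.norm_sq
    rwa [real_inner_comm, hS.inner_self, mul_zero] at h3
  have hc := is_const_of_deriv_eq_zero (fun s => (hd s).differentiableAt)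
    (fun s => (hd s).deriv) t 0
  simp only [zero_smul, NormedSpace.exp_zero, one_apply_eq_self] at hc
  exact (pow_left_inj₀ (norm_nonneg _) (norm_nonneg _) two_ne_zero).mp hc

theorem exp_smul_add_apply (S : E →L[ℝ] E) (s t : ℝ) (x : E) :
    NormedSpace.exp ((s + t) • S) x = NormedSpace.exp (s • S) (NormedSpace.exp (t • S) x) := by
  let _ : NormedAlgebra ℚ (E →L[ℝ] E) := NormedAlgebra.restrictScalars ℚ ℝ _
  rw [add_smul, NormedSpace.exp_add_of_commute (((Commute.refl S).smul_left s).smul_right t)]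
  rfl

/-- Two commuting skew-adjoint generators produce groups that are close where the generators
are. -/
theorem IsSkew.norm_exp_sub_exp_le {S R : E →L[ℝ] E} (hS : IsSkew S) (hR : IsSkew R)
    (hSR : Commute S R) (t : ℝ) (x : E) :
    ‖NormedSpace.exp (t • S) x - NormedSpace.exp (t • R) x‖ ≤ ‖S x - R x‖ * |t| := by
  have hD : IsSkew (S - R) := fun x y => by
    simp only [_root_.sub_apply, inner_sub_left, inner_sub_right, hS x y, hR x y]
    ring
  have hmv : ‖NormedSpace.exp (t • (S - R)) x - NormedSpace.exp ((0 : ℝ) • (S - R)) x‖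
      ≤ ‖(S - R) x‖ * ‖t - 0‖ :=
    Convex.norm_image_sub_le_of_norm_hasDerivWithin_le
      (f := fun s : ℝ => NormedSpace.exp (s • (S - R)) x)
      (f' := fun s : ℝ => NormedSpace.exp (s • (S - R)) ((S - R) x)) (s := univ)
      (fun s _ => (hasDerivAt_exp_smul_apply _ _ _).hasDerivWithinAt)
      (fun s _ => (hD.norm_exp_apply _ _).le) convex_univ (mem_univ _) (mem_univ _)
  have hc : Commute (t • R) (t • (S - R)) :=
    ((hSR.symm.sub_right (Commute.refl R)).smul_left t).smul_right t
  -- Since the generators commute, the isometry `exp (t • R)` factors out and only `exp (t • (S -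
  -- R)) x - x` has to be estimated.
  have e1 : NormedSpace.exp (t • S) x
      = NormedSpace.exp (t • R) (NormedSpace.exp (t • (S - R)) x) := by
    have : t • S = t • R + t • (S - R) := by rw [← smul_add]; simp
    let _ : NormedAlgebra ℚ (E →L[ℝ] E) := NormedAlgebra.restrictScalars ℚ ℝ _
    rw [this, NormedSpace.exp_add_of_commute hc]
    rfl
  rw [e1, ← map_sub, hR.norm_exp_apply]
  simpa using hmv

/-- The inverse of an injective skew-adjoint operator is a strong limit of bounded skew-adjoint
operators. -/
theorem IsSkew.exists_approx_inverse {B : E →L[ℝ] E} (hB : IsSkew B)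
    (hinj : Function.Injective B) :
    ∃ S : ℕ → E →L[ℝ] E, (∀ n, IsSkew (S n)) ∧ (∀ n, Commute (S n) B) ∧
      (∀ n m, Commute (S n) (S m)) ∧ ∀ x, Tendsto (fun n => S n (B x)) atTop (𝓝 x) := by
  let ε : ℕ → ℝ := fun n => 1 / ((n : ℝ) + 1)
  have εpos : ∀ n, 0 < ε n := fun n => by positivity
  -- Since `-B²` is nonnegative, `V n = ε - B²` is coercive with constant `ε n`. The approximation
  -- of `B⁻¹` is `S n = -B (ε - B²)⁻¹`: it is bounded and skew, and it is a function of `B`, hence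
  -- everything commutes.
  let V : ℕ → E →L[ℝ] E := fun n => ε n • (1 : E →L[ℝ] E) - B * B
  have hV : ∀ n x, V n x = ε n • x - B (B x) := fun n x => rfl
  have hVinner : ∀ n x, ⟪V n x, x⟫ = ε n * ‖x‖ ^ 2 + ‖B x‖ ^ 2 := fun n x => by
    rw [hV, inner_sub_left, real_inner_smul_left, hB, real_inner_self_eq_norm_sq,
      real_inner_self_eq_norm_sq]
    ring
  have hunit : ∀ n, IsUnit (V n) := fun n =>
    ContinuousLinearMap.isUnit_of_forall_le_norm_inner_map (V n) (c := ⟨ε n, (εpos n).le⟩)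
      (εpos n) fun x => by
        rw [hVinner]
        refine le_trans ?_ (le_abs_self _)
        change ‖x‖ ^ 2 * ε n ≤ _
        nlinarith [sq_nonneg ‖B x‖]
  choose P hP using hunit
  have hBV : ∀ n, Commute B (V n) := fun n =>
    ((Commute.one_right B).smul_right _).sub_right ((Commute.refl B).mul_right (Commute.refl B))
  have hBP : ∀ n, Commute B (↑(P n)⁻¹ : E →L[ℝ] E) := fun n =>
    Commute.units_inv_right (by rw [hP]; exact hBV n)
  have hVV : ∀ n m, Commute (V n) (V m) := fun n m =>
    (((Commute.one_left (V m)).smul_left _)).sub_left ((hBV m).mul_left (hBV m))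
  have hPP : ∀ n m, Commute (↑(P n)⁻¹ : E →L[ℝ] E) (↑(P m)⁻¹ : E →L[ℝ] E) := fun n m =>
    Commute.units_inv_left (Commute.units_inv_right (by rw [hP, hP]; exact hVV n m))
  have hVP : ∀ n x, V n ((↑(P n)⁻¹ : E →L[ℝ] E) x) = x := fun n x => by
    have : (V n * (↑(P n)⁻¹ : E →L[ℝ] E)) = 1 := by rw [← hP]; simp
    exact congrArg (fun L : E →L[ℝ] E => L x) this
  have hPV : ∀ n x, (↑(P n)⁻¹ : E →L[ℝ] E) (V n x) = x := fun n x => by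
    have : ((↑(P n)⁻¹ : E →L[ℝ] E) * V n) = 1 := by rw [← hP]; simp
    exact congrArg (fun L : E →L[ℝ] E => L x) this
  have hVsymm : ∀ n x y, ⟪V n x, y⟫ = ⟪x, V n y⟫ := fun n x y => by
    rw [hV, hV, inner_sub_left, inner_sub_right, real_inner_smul_left, real_inner_smul_right,
      hB, hB]
    ring
  have hPsymm : ∀ n x y, ⟪(↑(P n)⁻¹ : E →L[ℝ] E) x, y⟫ = ⟪x, (↑(P n)⁻¹ : E →L[ℝ] E) y⟫ :=
    fun n x y => by
      conv_lhs => rw [← hVP n y]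
      rw [← hVsymm, hVP]
  have hPnorm : ∀ n x, ε n * ‖(↑(P n)⁻¹ : E →L[ℝ] E) x‖ ≤ ‖x‖ := fun n x => by
    set y := (↑(P n)⁻¹ : E →L[ℝ] E) x with hy
    have h1 := hVinner n y
    rw [hy, hVP, ← hy] at h1
    have h2 := real_inner_le_norm x y
    rcases (norm_nonneg y).eq_or_lt with h0 | h0
    · rw [← h0]; simp
    · have h3 : (ε n * ‖y‖) * ‖y‖ ≤ ‖x‖ * ‖y‖ := by nlinarith [sq_nonneg ‖B y‖]
      exact le_of_mul_le_mul_right h3 h0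
  have hBPx : ∀ n x, B ((↑(P n)⁻¹ : E →L[ℝ] E) x) = (↑(P n)⁻¹ : E →L[ℝ] E) (B x) :=
    fun n x => congrArg (fun L : E →L[ℝ] E => L x) (hBP n).eq
  have hdense : DenseRange (B ∘ B) := (hB.denseRange hinj).comp (hB.denseRange hinj) B.continuous
  -- The operators `ε (ε - B²)⁻¹` are bounded by `1`, so convergence need only be checked on the
  -- dense range of `B²`. There `(ε - B²)⁻¹ B² y = ε (ε - B²)⁻¹ y - y` stays bounded and the
  -- prefactor `ε` tends to `0`.
  have hlim : ∀ x, Tendsto (fun n => ε n • (↑(P n)⁻¹ : E →L[ℝ] E) x) atTop (𝓝 0) := by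
    intro x
    rw [Metric.tendsto_atTop]
    intro η hη
    obtain ⟨y, hy⟩ := hdense.exists_dist_lt x (half_pos hη)
    have ht : Tendsto (fun n => ε n * (2 * ‖y‖)) atTop (𝓝 0) := by
      simpa only [zero_mul] using
        (tendsto_one_div_add_atTop_nhds_zero_nat (𝕜 := ℝ)).mul_const (2 * ‖y‖)
    obtain ⟨N, hN⟩ := (Metric.tendsto_atTop.mp ht) (η / 2) (half_pos hη)
    refine ⟨N, fun n hn => ?_⟩
    have h1 := hN n hn
    rw [Real.dist_eq, sub_zero, abs_of_nonneg (by have := (εpos n).le; positivity)] at h1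
    have e : ε n • (↑(P n)⁻¹ : E →L[ℝ] E) x
        = ε n • (↑(P n)⁻¹ : E →L[ℝ] E) (x - B (B y))
          + ε n • (ε n • (↑(P n)⁻¹ : E →L[ℝ] E) y - y) := by
      have : B (B y) = ε n • y - V n y := by rw [hV]; abel
      rw [this, map_sub, map_sub, map_smul, hPV]
      module
    have b1 : ‖ε n • (↑(P n)⁻¹ : E →L[ℝ] E) (x - B (B y))‖ < η / 2 := by
      rw [norm_smul, Real.norm_of_nonneg (εpos n).le]
      refine (hPnorm n _).trans_lt ?_
      rwa [dist_eq_norm] at hy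
    have b2 : ‖ε n • (ε n • (↑(P n)⁻¹ : E →L[ℝ] E) y - y)‖ ≤ ε n * (2 * ‖y‖) := by
      rw [norm_smul, Real.norm_of_nonneg (εpos n).le]
      refine mul_le_mul_of_nonneg_left ?_ (εpos n).le
      refine (norm_sub_le _ _).trans ?_
      rw [norm_smul, Real.norm_of_nonneg (εpos n).le]
      linarith [hPnorm n y]
    rw [dist_zero_right, e]
    exact (norm_add_le _ _).trans_lt (by linarith)
  refine ⟨fun n => -(B * (↑(P n)⁻¹ : E →L[ℝ] E)), fun n x y => ?_, fun n => ?_, fun n m => ?_,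
    fun x => ?_⟩
  · change ⟪-(B ((↑(P n)⁻¹ : E →L[ℝ] E) x)), y⟫ = -⟪x, -(B ((↑(P n)⁻¹ : E →L[ℝ] E) y))⟫
    rw [inner_neg_left, inner_neg_right, hB, hPsymm, hBPx]
  · exact ((Commute.refl B).mul_left (hBP n).symm).neg_left
  · refine ((Commute.neg_left ?_).neg_right)
    exact ((Commute.refl B).mul_right (hBP m)).mul_left
      ((hBP n).symm.mul_right (hPP n m))
  · have e : ∀ n, (-(B * (↑(P n)⁻¹ : E →L[ℝ] E))) (B x) = x - ε n • (↑(P n)⁻¹ : E →L[ℝ] E) x := by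
      intro n
      change -(B ((↑(P n)⁻¹ : E →L[ℝ] E) (B x))) = _
      have h1 := hVP n x
      rw [hV] at h1
      rw [← hBPx]
      nth_rewrite 2 [← h1]
      abel
    simp only [e]
    simpa using tendsto_const_nhds.sub (hlim x)

/-- `U` is a strongly continuous group of isometries whose generator is the inverse of `B`. -/
structure IsUnitaryGroup (B : E →L[ℝ] E) (U : ℝ → E →L[ℝ] E) : Prop where
  norm_map : ∀ t x, ‖U t x‖ = ‖x‖
  map_zero : ∀ x, U 0 x = x
  map_add : ∀ s t x, U (s + t) x = U s (U t x)
  comm : ∀ t x, U t (B x) = B (U t x)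
  continuous : ∀ x, Continuous fun t => U t x
  hasDerivAt : ∀ x t, HasDerivAt (fun s => U s (B x)) (U t x) t

/-- The groups `exp (t S n)` consist of isometries and differ on `B y` by at most `|t| ‖S n (B y) -
S m (B y)‖`, which is small because `S n (B y)` converges to `y`. As the range of `B` is dense, they
converge strongly and uniformly on bounded time intervals. The limit inherits linearity, the
isometry property, the group law and commutation with `B`. Its derivative on `B x` is the limit of
the derivatives `exp (t S n) (S n (B x))`. -/
theorem IsSkew.exists_unitaryGroup {B : E →L[ℝ] E} (hB : IsSkew B)
    (hinj : Function.Injective B) : ∃ U : ℝ → E →L[ℝ] E, IsUnitaryGroup B U := by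
  obtain ⟨S, hS, hSB, hSS, hlim⟩ := hB.exists_approx_inverse hinj
  let V : ℕ → ℝ → E →L[ℝ] E := fun n t => NormedSpace.exp (t • S n)
  have hVnorm : ∀ n t x, ‖V n t x‖ = ‖x‖ := fun n t x => (hS n).norm_exp_apply t x
  have hdense := hB.denseRange hinj
  -- uniform Cauchy property on bounded time intervals
  have hcau : ∀ (x : E) (M : ℝ), 0 ≤ M → ∀ η > 0, ∃ N, ∀ n ≥ N, ∀ m ≥ N, ∀ t : ℝ, |t| ≤ M →
      ‖V n t x - V m t x‖ < η := by
    intro x M hM η hη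
    obtain ⟨y, hy⟩ := hdense.exists_dist_lt x (show 0 < η / 4 by positivity)
    rw [dist_eq_norm] at hy
    -- After multiplication by `|t| ≤ M` this tolerance costs at most `η / 2`; the two errors of
    -- size `η / 4` from replacing `x` by `B y` use up the rest. The `+ 1` covers `M = 0`.
    obtain ⟨N, hN⟩ := Metric.cauchySeq_iff.mp (hlim y).cauchySeq (η / (2 * (M + 1)))
      (by positivity)
    refine ⟨N, fun n hn m hm t ht => ?_⟩
    have h1 := hN n hn m hm
    rw [dist_eq_norm] at h1
    have h2 := (hS n).norm_exp_sub_exp_le (hS m) (hSS n m) t (B y)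
    have h3 : ‖S n (B y) - S m (B y)‖ * |t| ≤ η / 2 := by
      calc _ ≤ η / (2 * (M + 1)) * (M + 1) := by gcongr; linarith
        _ = η / 2 := by field_simp
    have e : V n t x - V m t x
        = V n t (x - B y) + (V n t (B y) - V m t (B y)) - V m t (x - B y) := by
      rw [_root_.map_sub, _root_.map_sub]; abel
    rw [e]
    have b1 := norm_sub_le (V n t (x - B y) + (V n t (B y) - V m t (B y))) (V m t (x - B y))
    have b2 := norm_add_le (V n t (x - B y)) (V n t (B y) - V m t (B y))
    rw [hVnorm] at b1 b2
    have b3 : ‖V n t (B y) - V m t (B y)‖ ≤ η / 2 := h2.trans h3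
    linarith
  have hex : ∀ t x, ∃ l, Tendsto (fun n => V n t x) atTop (𝓝 l) := by
    intro t x
    refine cauchySeq_tendsto_of_complete (Metric.cauchySeq_iff.mpr fun η hη => ?_)
    obtain ⟨N, hN⟩ := hcau x |t| (abs_nonneg t) η hη
    exact ⟨N, fun n hn m hm => by rw [dist_eq_norm]; exact hN n hn m hm t le_rfl⟩
  choose W hW using hex
  have hWnorm : ∀ t x, ‖W t x‖ = ‖x‖ := fun t x => by
    have h1 := (hW t x).norm
    simp only [hVnorm] at h1
    exact tendsto_nhds_unique h1 tendsto_const_nhds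
  have hWadd : ∀ t x y, W t (x + y) = W t x + W t y := fun t x y => by
    have h1 := (hW t x).add (hW t y)
    simp only [← _root_.map_add] at h1
    exact tendsto_nhds_unique (hW t (x + y)) h1
  have hWsmul : ∀ t (c : ℝ) x, W t (c • x) = c • W t x := fun t c x => by
    have h1 := (hW t x).const_smul c
    simp only [← map_smul] at h1
    exact tendsto_nhds_unique (hW t (c • x)) h1
  let U : ℝ → E →L[ℝ] E := fun t =>
    LinearMap.mkContinuous { toFun := W t, map_add' := hWadd t, map_smul' := hWsmul t } 1
      fun x => by rw [one_mul]; exact (hWnorm t x).le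
  have hU : ∀ t x, Tendsto (fun n => V n t x) atTop (𝓝 (U t x)) := hW
  have hUnorm : ∀ t x, ‖U t x‖ = ‖x‖ := hWnorm
  -- uniform convergence on bounded time intervals
  have hunif : ∀ (x : E) (M : ℝ), 0 ≤ M → ∀ η > 0, ∃ N, ∀ n ≥ N, ∀ t : ℝ, |t| ≤ M →
      ‖V n t x - U t x‖ ≤ η := by
    intro x M hM η hη
    obtain ⟨N, hN⟩ := hcau x M hM η hη
    refine ⟨N, fun n hn t ht => ?_⟩
    have h1 : Tendsto (fun m => ‖V n t x - V m t x‖) atTop (𝓝 ‖V n t x - U t x‖) :=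
      (tendsto_const_nhds.sub (hU t x)).norm
    exact le_of_tendsto h1 (eventually_atTop.mpr ⟨N, fun m hm => (hN n hn m hm t ht).le⟩)
  have hderiv : ∀ x t, HasDerivAt (fun s => U s (B x)) (U t x) t := by
    intro x t
    -- The derivatives converge uniformly on a ball around `0` containing `t`: isometry of `V n s`
    -- makes the error `S n (B x) - x` independent of `s`, and `V n s x` converges uniformly there.
    refine hasDerivAt_of_tendstoUniformlyOn (l := atTop) (x := t)
      (g' := fun s => U s x) (f := fun n s => V n s (B x))
      (f' := fun n s => V n s (S n (B x))) (s := Metric.ball 0 (|t| + 1)) Metric.isOpen_ball ?_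
      (Eventually.of_forall fun n s _ => hasDerivAt_exp_smul_apply (S n) (B x) s)
      (fun s _ => hU s (B x)) (by simp)
    rw [Metric.tendstoUniformlyOn_iff]
    intro η hη
    obtain ⟨N, hN⟩ := hunif x (|t| + 1) (by positivity) (η / 3) (by positivity)
    obtain ⟨N', hN'⟩ := Metric.tendsto_atTop.mp (hlim x) (η / 3) (by positivity)
    filter_upwards [eventually_ge_atTop N, eventually_ge_atTop N'] with n hn hn' s hs
    have hs' : |s| ≤ |t| + 1 := by
      rw [Metric.mem_ball, dist_zero_right, Real.norm_eq_abs] at hs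
      exact hs.le
    have h1 := hN n hn s hs'
    have h2 := hN' n hn'
    rw [dist_eq_norm] at h2
    rw [dist_comm, dist_eq_norm]
    have e : V n s (S n (B x)) - U s x = V n s (S n (B x) - x) + (V n s x - U s x) := by
      rw [_root_.map_sub]; abel
    rw [e]
    refine (norm_add_le _ _).trans_lt ?_
    rw [hVnorm]
    linarith
  have hVadd : ∀ n s t x, V n (s + t) x = V n s (V n t x) := fun n s t x =>
    exp_smul_add_apply (S n) s t x
  refine ⟨U, hUnorm, fun x => ?_, fun s t x => ?_, fun t x => ?_, fun x => ?_, hderiv⟩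
  · have h1 := hU 0 x
    have e : ∀ n, V n 0 x = x := fun n => by simp [V]
    simp only [e] at h1
    exact (tendsto_nhds_unique h1 tendsto_const_nhds)
  · have h1 : Tendsto (fun n => V n s (V n t x - U t x) + V n s (U t x)) atTop
        (𝓝 (0 + U s (U t x))) := by
      refine Tendsto.add ?_ (hU s _)
      rw [tendsto_zero_iff_norm_tendsto_zero]
      simp only [hVnorm]
      exact tendsto_iff_norm_sub_tendsto_zero.mp (hU t x)
    simp only [_root_.map_sub, sub_add_cancel, ← hVadd, zero_add] at h1
    exact tendsto_nhds_unique (hU (s + t) x) h1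
  · have e : ∀ n, V n t (B x) = B (V n t x) := fun n => by
      have hc : Commute (NormedSpace.exp (t • S n)) B := ((hSB n).smul_left t).exp_left
      exact congrArg (fun L : E →L[ℝ] E => L x) hc.eq
    have h1 := (B.continuous.tendsto _).comp (hU t x)
    refine tendsto_nhds_unique (hU t (B x)) ?_
    simp only [e]
    exact h1
  · have hloc : TendstoLocallyUniformly (fun n t => V n t x) (fun t => U t x) atTop := by
      rw [tendstoLocallyUniformly_iff_forall_isCompact]
      intro K hK
      obtain ⟨M, hM⟩ := hK.isBounded.exists_norm_le
      rw [Metric.tendstoUniformlyOn_iff]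
      intro η hη
      obtain ⟨N, hN⟩ := hunif x (max M 0) (le_max_right _ _) (η / 2) (by positivity)
      filter_upwards [eventually_ge_atTop N] with n hn s hs
      rw [dist_comm, dist_eq_norm]
      exact (hN n hn s ((hM s hs).trans (le_max_left _ _))).trans_lt (by linarith)
    refine hloc.continuous (Frequently.of_forall fun n => ?_)
    exact continuous_iff_continuousAt.mpr fun t => (hasDerivAt_exp_smul_apply (S n) x t).continuousAt

end SkewGroup

/-! ### Exchanging the order of integration over a triangle -/

/-- Both sides are the integral of `L (f t) (g s)` over the triangle `s < t`. This stands in for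
integration by parts when `f` and `g` are merely integrable. It yields weak derivatives of
primitives, the integrated equation for mild solutions and the forward-backward duality. -/
theorem integral_bilin_primitive_swap {E F G : Type*} [NormedAddCommGroup E] [NormedSpace ℝ E]
    [CompleteSpace E] [NormedAddCommGroup F] [NormedSpace ℝ F] [CompleteSpace F]
    [NormedAddCommGroup G] [NormedSpace ℝ G] [CompleteSpace G] (L : E →L[ℝ] F →L[ℝ] G)
    {f : ℝ → E} {g : ℝ → F} {a b : ℝ} (hab : a ≤ b) (hf : IntervalIntegrable f volume a b)
    (hg : IntervalIntegrable g volume a b) :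
    ∫ t in a..b, L (f t) (∫ s in a..t, g s) = ∫ s in a..b, L (∫ t in s..b, f t) (g s) := by
  rw [intervalIntegrable_iff_integrableOn_Ioc_of_le hab] at hf hg
  rw [intervalIntegral.integral_of_le hab, intervalIntegral.integral_of_le hab]
  set μ := (volume : Measure ℝ).restrict (Ioc a b) with hμ
  let Δ : Set (ℝ × ℝ) := {p | p.2 < p.1}
  have hΔ : MeasurableSet Δ := measurableSet_lt measurable_snd measurable_fst
  have hprod : Integrable (fun p : ℝ × ℝ => L (f p.1) (g p.2)) (μ.prod μ) := by
    refine Integrable.mono' ((hf.norm.mul_prod hg.norm).const_mul ‖L‖)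
      (L.aestronglyMeasurable_comp₂ hf.1.comp_fst hg.1.comp_snd) (Eventually.of_forall fun p => ?_)
    rw [← mul_assoc]
    exact L.le_opNorm₂ _ _
  have hsw := integral_integral_swap (f := fun t s => Δ.indicator
    (fun p : ℝ × ℝ => L (f p.1) (g p.2)) (t, s)) (μ := μ) (ν := μ) (hprod.indicator hΔ)
  have h1 : ∀ t ∈ Ioc a b, ∫ s, Δ.indicator (fun p : ℝ × ℝ => L (f p.1) (g p.2)) (t, s) ∂μ
      = L (f t) (∫ s in a..t, g s) := by
    intro t ht
    have e : (fun s => Δ.indicator (fun p : ℝ × ℝ => L (f p.1) (g p.2)) (t, s))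
        = (Iio t).indicator (fun s => L (f t) (g s)) := by
      ext s
      by_cases h : s < t <;> simp [Δ, indicator, h]
    have hset : Iio t ∩ Ioc a b = Ioo a t := by
      ext s
      simp only [mem_inter_iff, mem_Iio, mem_Ioc, mem_Ioo]
      exact ⟨fun h => ⟨h.2.1, h.1⟩, fun h => ⟨h.2, h.1, h.2.le.trans ht.2⟩⟩
    rw [e, integral_indicator measurableSet_Iio, Measure.restrict_restrict measurableSet_Iio, hset,
      intervalIntegral.integral_of_le ht.1.le, integral_Ioc_eq_integral_Ioo]
    exact (L (f t)).integral_comp_comm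
      (hg.mono_set fun s hs => ⟨hs.1, hs.2.le.trans ht.2⟩)
  have h2 : ∀ s ∈ Ioc a b, ∫ t, Δ.indicator (fun p : ℝ × ℝ => L (f p.1) (g p.2)) (t, s) ∂μ
      = L (∫ t in s..b, f t) (g s) := by
    intro s hs
    have e : (fun t => Δ.indicator (fun p : ℝ × ℝ => L (f p.1) (g p.2)) (t, s))
        = (Ioi s).indicator (fun t => L.flip (g s) (f t)) := by
      ext t
      by_cases h : s < t <;> simp [Δ, indicator, h]
    have hset : Ioi s ∩ Ioc a b = Ioc s b := by
      ext t
      simp only [mem_inter_iff, mem_Ioi, mem_Ioc]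
      exact ⟨fun h => ⟨h.1, h.2.2⟩, fun h => ⟨h.1, hs.1.trans h.1, h.2⟩⟩
    rw [e, integral_indicator measurableSet_Ioi, Measure.restrict_restrict measurableSet_Ioi, hset,
      intervalIntegral.integral_of_le hs.2]
    exact (L.flip (g s)).integral_comp_comm (hf.mono_set fun t ht => ⟨hs.1.trans ht.1, ht.2⟩)
  rw [← setIntegral_congr_fun measurableSet_Ioc h1, ← setIntegral_congr_fun measurableSet_Ioc h2]
  exact hsw

/-! ### Mild solutions -/

section Mild

variable {E : Type*} [NormedAddCommGroup E] [InnerProductSpace ℝ E]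
  {B : E →L[ℝ] E} {U : ℝ → E →L[ℝ] E}

/-- A continuous curve `D` with `(B D)' = D` and `D T = 0` vanishes. -/
theorem IsSkew.eq_zero_of_hasDerivWithinAt (hB : IsSkew B) (hinj : Function.Injective B) {T : ℝ}
    {D : ℝ → E} (hD : ∀ t ∈ Icc 0 T, HasDerivWithinAt (fun s => B (D s)) (D t) (Icc 0 T) t)
    (hT : D T = 0) {t : ℝ} (ht : t ∈ Icc 0 T) : D t = 0 := by
  -- The derivative of `‖B D‖²` is `2 ⟪B D, D⟫`, zero by skewness; so `‖B D‖` is conserved.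
  have hd : ∀ s ∈ Icc 0 T, HasDerivWithinAt (fun s => ‖B (D s)‖ ^ 2) 0 (Icc 0 T) s := by
    intro s hs
    have h := (hD s hs).norm_sq
    rwa [hB.inner_self, mul_zero] at h
  have hmv := Convex.norm_image_sub_le_of_norm_hasDerivWithin_le (C := 0) hd
    (fun s _ => by simp) (convex_Icc 0 T) (right_mem_Icc.mpr (ht.1.trans ht.2)) ht
  rw [hT, map_zero, norm_zero, zero_mul, norm_le_zero_iff, zero_pow two_ne_zero, sub_zero,
    sq_eq_zero_iff, norm_eq_zero] at hmv
  exact hinj (by rw [hmv, map_zero])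

namespace IsUnitaryGroup

/-- Strong continuity becomes joint continuity because every `U t` is an isometry. It makes `s ↦ U
(-s) (f s)` measurable. -/
theorem continuous_uncurry (hU : IsUnitaryGroup B U) : Continuous fun p : ℝ × E => U p.1 p.2 := by
  rw [continuous_iff_continuousAt]
  rintro ⟨t₀, x₀⟩
  have h1 : Tendsto (fun p : ℝ × E => ‖p.2 - x₀‖ + ‖U p.1 x₀ - U t₀ x₀‖) (𝓝 (t₀, x₀)) (𝓝 0) := by
    have hc : Continuous fun p : ℝ × E => ‖p.2 - x₀‖ + ‖U p.1 x₀ - U t₀ x₀‖ :=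
      (continuous_snd.sub continuous_const).norm.add
        (((hU.continuous x₀).comp continuous_fst).sub continuous_const).norm
    simpa using hc.tendsto (t₀, x₀)
  refine tendsto_iff_norm_sub_tendsto_zero.mpr
    (squeeze_zero (fun _ => norm_nonneg _) (fun p => ?_) h1)
  have e : U p.1 p.2 - U t₀ x₀ = U p.1 (p.2 - x₀) + (U p.1 x₀ - U t₀ x₀) := by
    rw [map_sub]; abel
  rw [e]
  refine (norm_add_le _ _).trans ?_
  rw [hU.norm_map]

theorem neg_apply_apply (hU : IsUnitaryGroup B U) (t : ℝ) (x : E) : U (-t) (U t x) = x := by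
  rw [← hU.map_add, neg_add_cancel, hU.map_zero]

theorem inner_map_map (hU : IsUnitaryGroup B U) (t : ℝ) (x y : E) : ⟪U t x, U t y⟫ = ⟪x, y⟫ :=
  LinearIsometry.inner_map_map ⟨(U t : E →ₗ[ℝ] E), hU.norm_map t⟩ x y

theorem inner_map_left (hU : IsUnitaryGroup B U) (t : ℝ) (x y : E) :
    ⟪U t x, y⟫ = ⟪x, U (-t) y⟫ := by
  rw [← hU.inner_map_map (-t) (U t x) y, hU.neg_apply_apply]

/-- The curve `s ↦ U s (B x)` has speed `‖U s x‖ = ‖x‖`. The factor `|t|` is the origin of the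
kernel `t - s` in the Duhamel estimate. -/
theorem norm_comm_apply_sub_le (hU : IsUnitaryGroup B U) (x : E) (t : ℝ) :
    ‖U t (B x) - B x‖ ≤ ‖x‖ * |t| := by
  have hmv := Convex.norm_image_sub_le_of_norm_hasDerivWithin_le
      (f := fun s : ℝ => U s (B x)) (f' := fun s : ℝ => U s x) (s := univ)
      (fun s _ => (hU.hasDerivAt x s).hasDerivWithinAt)
      (fun s _ => (hU.norm_map s x).le) convex_univ (mem_univ 0) (mem_univ t)
  simpa [hU.map_zero] using hmv

theorem integrable_map_neg (hU : IsUnitaryGroup B U) {f : ℝ → E} (hf : Integrable f) :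
    Integrable fun s => U (-s) (f s) := by
  refine hf.norm.mono' ?_ (Eventually.of_forall fun s => (hU.norm_map _ _).le)
  exact hU.continuous_uncurry.comp_aestronglyMeasurable
    (f := fun s : ℝ => (-s, f s)) (continuous_neg.aestronglyMeasurable.prodMk hf.1)

variable [CompleteSpace E]

theorem integral_map_neg (hU : IsUnitaryGroup B U) (x : E) (t : ℝ) :
    ∫ s in (0 : ℝ)..t, U (-s) x = B x - U (-t) (B x) := by
  have hd : ∀ s ∈ uIcc 0 t, HasDerivAt (fun s => -U (-s) (B x)) (U (-s) x) s := fun s _ => by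
    have h1 := ((hU.hasDerivAt x (-s)).scomp s (hasDerivAt_neg s)).neg
    refine (h1.congr_deriv ?_)
    simp
  have hc : Continuous fun s => U (-s) x := (hU.continuous x).comp continuous_neg
  rw [intervalIntegral.integral_eq_sub_of_hasDerivAt hd (hc.intervalIntegrable _ _)]
  rw [neg_zero, hU.map_zero]
  abel

end IsUnitaryGroup

/-- The mild solution of `Y' = B⁻¹ Y + f`, `Y 0 = c`. -/
def mild (U : ℝ → E →L[ℝ] E) (c : E) (f : ℝ → E) (t : ℝ) : E :=
  U t (c + ∫ s in (0 : ℝ)..t, U (-s) (f s))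

theorem mild_zero (hU : IsUnitaryGroup B U) (c : E) (f : ℝ → E) : mild U c f 0 = c := by
  simp [mild, hU.map_zero]

theorem continuous_mild (hU : IsUnitaryGroup B U) (c : E) {f : ℝ → E} (hf : Integrable f) :
    Continuous (mild U c f) := by
  have h1 : Continuous fun t => c + ∫ s in (0 : ℝ)..t, U (-s) (f s) :=
    continuous_const.add
      (intervalIntegral.continuous_primitive
        (fun a b => (hU.integrable_map_neg hf).intervalIntegrable) 0)
  exact hU.continuous_uncurry.comp (continuous_id.prodMk h1)

variable [CompleteSpace E]

/-- This is the equation `Y' = B⁻¹ Y + f` after applying `B` and integrating in time, which makes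
sense for merely integrable `f`. Paired with a fixed `x`, skewness moves `B` and `U t` onto `x`,
where `U (-t) (B x) = B x - ∫ U (-s) x` is explicit. Writing `a t = a s + ∫ₛᵗ` and exchanging
integrals over the triangle leaves the claimed right-hand side. -/
theorem map_mild (hU : IsUnitaryGroup B U) (hB : IsSkew B) (c : E) {f : ℝ → E}
    (hf : Integrable f) {t : ℝ} (ht : 0 ≤ t) :
    B (mild U c f t) = B c + ∫ s in (0 : ℝ)..t, (mild U c f s + B (f s)) := by
  have hh := hU.integrable_map_neg hf
  have hm := continuous_mild hU c hf
  have hBf : Integrable fun s => B (f s) := B.integrable_comp hf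
  have hx : ∀ x : E, Continuous fun s => U (-s) x := fun x => (hU.continuous x).comp continuous_neg
  set a : ℝ → E := fun t => c + ∫ s in (0 : ℝ)..t, U (-s) (f s) with ha
  have hac : Continuous a := continuous_const.add
    (intervalIntegral.continuous_primitive (fun a b => hh.intervalIntegrable) 0)
  refine ext_inner_right ℝ fun x => ?_
  have e1 : ⟪B (mild U c f t), x⟫ = -⟪a t, B x⟫ + ∫ s in (0 : ℝ)..t, ⟪a t, U (-s) x⟫ := by
    have h1 : ∫ s in (0 : ℝ)..t, ⟪a t, U (-s) x⟫ = ⟪a t, ∫ s in (0 : ℝ)..t, U (-s) x⟫ :=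
      (innerSL ℝ (a t)).intervalIntegral_comp_comm ((hx x).intervalIntegrable 0 t)
    rw [h1, hU.integral_map_neg, inner_sub_right, hB]
    change -⟪U t (a t), B x⟫ = _
    rw [hU.inner_map_left]
    ring
  have e2 : ∫ s in (0 : ℝ)..t, ⟪a t, U (-s) x⟫ = (∫ s in (0 : ℝ)..t, ⟪a s, U (-s) x⟫)
      + ∫ s in (0 : ℝ)..t, ⟪∫ τ in s..t, U (-τ) (f τ), U (-s) x⟫ := by
    rw [← intervalIntegral.integral_add]
    · refine intervalIntegral.integral_congr fun s _ => ?_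
      simp only [ha]
      rw [← inner_add_left, add_assoc,
        intervalIntegral.integral_add_adjacent_intervals hh.intervalIntegrable
          hh.intervalIntegrable]
    · exact (hac.inner (hx x)).intervalIntegrable _ _
    · have : (fun s => ⟪∫ τ in s..t, U (-τ) (f τ), U (-s) x⟫)
          = fun s => ⟪a t - a s, U (-s) x⟫ := by
        ext s
        simp only [ha]
        rw [add_sub_add_left_eq_sub,
          intervalIntegral.integral_interval_sub_left hh.intervalIntegrable hh.intervalIntegrable]
      rw [this]
      exact ((continuous_const.sub hac).inner (hx x)).intervalIntegrable _ _
  have e3 : ∫ s in (0 : ℝ)..t, ⟪∫ τ in s..t, U (-τ) (f τ), U (-s) x⟫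
      = ⟪a t - c, B x⟫ - ∫ s in (0 : ℝ)..t, ⟪f s, B x⟫ := by
    have h1 := integral_bilin_primitive_swap (innerSL ℝ) (f := fun s => U (-s) (f s))
      (g := fun s => U (-s) x) ht hh.intervalIntegrable ((hx x).intervalIntegrable 0 t)
    change ∫ s in (0 : ℝ)..t, ⟪U (-s) (f s), ∫ τ in (0 : ℝ)..s, U (-τ) x⟫ = _ at h1
    refine h1.symm.trans ?_
    have h2 : ⟪a t - c, B x⟫ = ∫ s in (0 : ℝ)..t, ⟪U (-s) (f s), B x⟫ := by
      simp only [ha, add_sub_cancel_left]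
      have := ((innerSL ℝ).flip (B x)).intervalIntegral_comp_comm
        (hh.intervalIntegrable (a := 0) (b := t))
      exact this.symm
    rw [h2, ← intervalIntegral.integral_sub]
    · refine intervalIntegral.integral_congr fun s _ => ?_
      rw [hU.integral_map_neg, inner_sub_right, hU.inner_map_map]
    · exact (hh.inner_const (B x)).intervalIntegrable
    · exact (hf.inner_const (B x)).intervalIntegrable
  have e4 : ⟪B c + ∫ s in (0 : ℝ)..t, (mild U c f s + B (f s)), x⟫
      = -⟪c, B x⟫ + ((∫ s in (0 : ℝ)..t, ⟪a s, U (-s) x⟫) - ∫ s in (0 : ℝ)..t, ⟪f s, B x⟫) := by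
    rw [inner_add_left, hB]
    congr 1
    have hi : IntervalIntegrable (fun s => mild U c f s + B (f s)) volume 0 t :=
      (hm.intervalIntegrable _ _).add hBf.intervalIntegrable
    have h1 := ((innerSL ℝ).flip x).intervalIntegral_comp_comm hi
    change _ = ⟪_, x⟫ at h1
    rw [← h1, ← intervalIntegral.integral_sub]
    · refine intervalIntegral.integral_congr fun s _ => ?_
      change ⟪mild U c f s + B (f s), x⟫ = _
      rw [inner_add_left, hB (f s)]
      change ⟪U s (a s), x⟫ + _ = _
      rw [hU.inner_map_left]
      ring
    · exact (hac.inner (hx x)).intervalIntegrable _ _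
    · exact (hf.inner_const (B x)).intervalIntegrable
  rw [e4, e1, e2, e3, inner_sub_left]
  ring

end Mild

/-! ### Volterra equations with a second order kernel -/

section Volterra

variable {H : Type*} [NormedAddCommGroup H]

theorem integral_sub_mul_exp (κ t : ℝ) :
    κ ^ 2 * ∫ s in (0 : ℝ)..t, (t - s) * Real.exp (κ * s) = Real.exp (κ * t) - 1 - κ * t := by
  have hd : ∀ s ∈ uIcc 0 t, HasDerivAt (fun s => (κ * (t - s) + 1) * Real.exp (κ * s))
      (κ ^ 2 * ((t - s) * Real.exp (κ * s))) s := fun s _ => by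
    have h1 : HasDerivAt (fun s => κ * (t - s) + 1) (-κ) s := by
      have := (((hasDerivAt_id s).const_sub t).const_mul κ).add_const 1
      simpa using this
    have h2 : HasDerivAt (fun s => Real.exp (κ * s)) (Real.exp (κ * s) * κ) s := by
      have := ((hasDerivAt_id s).const_mul κ).exp
      simpa using this
    exact (h1.mul h2).congr_deriv (by ring)
  have hc : Continuous fun s => κ ^ 2 * ((t - s) * Real.exp (κ * s)) := by fun_prop
  rw [← intervalIntegral.integral_const_mul,
    intervalIntegral.integral_eq_sub_of_hasDerivAt hd (hc.intervalIntegrable _ _)]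
  simp
  ring

/-- For the rate `κ = 2 √M` one has `κ² = 4 M`, and two integrations of `exp (κ s)` gain `κ⁻²`.
Hence the factor `1/4`, whatever the value of `M`; any rate larger than `√M` by a fixed factor would
contract. -/
theorem mul_integral_sub_mul_exp_le {M : ℝ} (hM : 0 ≤ M) {t : ℝ} (ht : 0 ≤ t) :
    M * ∫ s in (0 : ℝ)..t, (t - s) * Real.exp (2 * √M * s)
      ≤ 1 / 4 * Real.exp (2 * √M * t) := by
  have h := integral_sub_mul_exp (2 * √M) t
  have e : (2 * √M) ^ 2 = 4 * M := by rw [mul_pow, Real.sq_sqrt hM]; norm_num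
  rw [e] at h
  have : 0 ≤ 2 * √M * t := by positivity
  linarith

theorem integral_sub_mul_le {y : ℝ → ℝ} (hy : Continuous y) {T M N : ℝ} (hM : 0 ≤ M)
    (hN : ∀ s ∈ Icc 0 T, y s ≤ N * Real.exp (2 * √M * s)) (hN0 : 0 ≤ N) {t : ℝ}
    (ht : t ∈ Icc 0 T) :
    M * ∫ s in (0 : ℝ)..t, (t - s) * y s ≤ N / 4 * Real.exp (2 * √M * t) := by
  have h1 : ∫ s in (0 : ℝ)..t, (t - s) * y s
      ≤ ∫ s in (0 : ℝ)..t, N * ((t - s) * Real.exp (2 * √M * s)) := by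
    refine intervalIntegral.integral_mono_on ht.1 (Continuous.intervalIntegrable (by fun_prop) _ _)
      (Continuous.intervalIntegrable (by fun_prop) _ _) fun s hs => ?_
    have := hN s ⟨hs.1, hs.2.trans ht.2⟩
    have h0 : 0 ≤ t - s := by linarith [hs.2]
    nlinarith
  rw [intervalIntegral.integral_const_mul] at h1
  have h2 := mul_integral_sub_mul_exp_le hM ht.1
  calc _ ≤ M * (N * ∫ s in (0 : ℝ)..t, (t - s) * Real.exp (2 * √M * s)) := by gcongr
    _ = N * (M * ∫ s in (0 : ℝ)..t, (t - s) * Real.exp (2 * √M * s)) := by ring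
    _ ≤ N * (1 / 4 * Real.exp (2 * √M * t)) := by gcongr
    _ = _ := by ring

/-- A Gronwall inequality of second order. -/
theorem norm_le_of_volterra {u : ℝ → H} (hu : Continuous u) {T M a : ℝ} (hM : 0 ≤ M)
    (ha : 0 ≤ a)
    (h : ∀ t ∈ Icc 0 T, ‖u t‖ ≤ a + M * ∫ s in (0 : ℝ)..t, (t - s) * ‖u s‖) {t : ℝ}
    (ht : t ∈ Icc 0 T) : ‖u t‖ ≤ 4 / 3 * a * Real.exp (2 * √M * t) := by
  have hc : ContinuousOn (fun s => Real.exp (-(2 * √M * s)) * ‖u s‖) (Icc 0 T) := by fun_prop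
  -- At a maximum point of the weighted norm the hypothesis reads `N ≤ a + N / 4`, whence `N ≤ 4 / 3
  -- * a`.
  obtain ⟨t₀, ht₀, hmax⟩ := isCompact_Icc.exists_isMaxOn ⟨t, ht⟩ hc
  set N := Real.exp (-(2 * √M * t₀)) * ‖u t₀‖ with hN
  have hN0 : 0 ≤ N := by positivity
  have key : ∀ s, Real.exp (2 * √M * s) * Real.exp (-(2 * √M * s)) = 1 := fun s => by
    rw [← Real.exp_add]; simp
  have hle : ∀ s ∈ Icc 0 T, ‖u s‖ ≤ N * Real.exp (2 * √M * s) := fun s hs => by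
    have h1 : Real.exp (-(2 * √M * s)) * ‖u s‖ ≤ N := hmax hs
    have h2 := mul_le_mul_of_nonneg_right h1 (Real.exp_nonneg (2 * √M * s))
    calc ‖u s‖ = (Real.exp (2 * √M * s) * Real.exp (-(2 * √M * s))) * ‖u s‖ := by
          rw [key, one_mul]
      _ ≤ _ := by linarith
  have h3 := (h t₀ ht₀).trans (add_le_add_right
    (integral_sub_mul_le hu.norm hM hle hN0 ht₀) a)
  have h4 : N ≤ a + N / 4 := by
    have hexp : 1 ≤ Real.exp (2 * √M * t₀) :=
      Real.one_le_exp (by have := ht₀.1; positivity)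
    have h5 : ‖u t₀‖ ≤ (a + N / 4) * Real.exp (2 * √M * t₀) := by nlinarith
    calc N ≤ Real.exp (-(2 * √M * t₀)) * ((a + N / 4) * Real.exp (2 * √M * t₀)) := by
          rw [hN]; gcongr
      _ = (a + N / 4) * (Real.exp (2 * √M * t₀) * Real.exp (-(2 * √M * t₀))) := by ring
      _ = _ := by rw [key, mul_one]
  refine (hle t ht).trans ?_
  gcongr
  linarith

/-- Volterra equations with a second order kernel are solvable. -/
theorem exists_volterra_solution [NormedSpace ℝ H] [CompleteSpace H] {T M : ℝ} (hT : 0 ≤ T) (hM : 0 ≤ M)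
    (K : (ℝ → H) → ℝ → H) (hKc : ∀ f, Continuous f → Continuous (K f))
    (hK : ∀ f g, Continuous f → Continuous g → ∀ t ∈ Icc 0 T,
      ‖K f t - K g t‖ ≤ M * ∫ s in (0 : ℝ)..t, (t - s) * ‖f s - g s‖)
    {h : ℝ → H} (hh : Continuous h) :
    ∃ u : ℝ → H, Continuous u ∧ ∀ t ∈ Icc 0 T, u t = h t - K u t := by
  set κ := 2 * √M with hκ
  -- The unknown is `v t = exp (-κ t) u t`, and `e` recovers `u`. In the sup norm for `v` the
  -- fixed-point map contracts by `1/4` on the whole of `[0,T]`, so no subdivision of the interval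
  -- is needed.
  let e : C(Icc 0 T, H) → ℝ → H := fun v s => Real.exp (κ * s) • v (projIcc 0 T hT s)
  have he : ∀ v, Continuous (e v) := fun v => by
    have : Continuous fun s => v (projIcc 0 T hT s) := v.continuous.comp continuous_projIcc
    fun_prop
  let Φ : C(Icc 0 T, H) → C(Icc 0 T, H) := fun v =>
    ⟨fun t => Real.exp (-(κ * t)) • (h t - K (e v) t), by
      have := hKc _ (he v)
      fun_prop⟩
  have key : ∀ s, Real.exp (κ * s) * Real.exp (-(κ * s)) = 1 := fun s => by
    rw [← Real.exp_add]; simp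
  have hΦ : ContractingWith (1 / 4) Φ := by
    refine ⟨by rw [← NNReal.coe_lt_coe]; norm_num, LipschitzWith.of_dist_le_mul fun v w => ?_⟩
    rw [ContinuousMap.dist_le (by positivity)]
    intro t
    rw [dist_eq_norm]
    change ‖Real.exp (-(κ * t)) • (h t - K (e v) t) - Real.exp (-(κ * t)) • (h t - K (e w) t)‖ ≤ _
    rw [← smul_sub, sub_sub_sub_cancel_left, norm_smul, Real.norm_of_nonneg (Real.exp_nonneg _)]
    have h1 := hK _ _ (he w) (he v) t t.2
    have h2 : ∀ s ∈ Icc 0 T, ‖e w s - e v s‖ ≤ dist v w * Real.exp (2 * √M * s) := by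
      intro s hs
      simp only [e]
      rw [← smul_sub, norm_smul, Real.norm_of_nonneg (Real.exp_nonneg _), mul_comm,
        ← dist_eq_norm, dist_comm]
      gcongr
      exact ContinuousMap.dist_apply_le_dist _
    have h3 := h1.trans (integral_sub_mul_le ((he w).sub (he v)).norm hM h2 dist_nonneg t.2)
    calc _ ≤ Real.exp (-(κ * t)) * (dist v w / 4 * Real.exp (κ * t)) := by gcongr
      _ = dist v w / 4 * (Real.exp (κ * t) * Real.exp (-(κ * t))) := by ring
      _ = dist v w / 4 := by rw [key, mul_one]
      _ = _ := by push_cast; ring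
  let v := hΦ.fixedPoint
  have hv : Φ v = v := hΦ.fixedPoint_isFixedPt
  refine ⟨e v, he v, fun t ht => ?_⟩
  have h1 : Real.exp (-(κ * t)) • (h t - K (e v) t) = v ⟨t, ht⟩ := by
    have := congrArg (fun w : C(Icc 0 T, H) => w ⟨t, ht⟩) hv
    exact this
  have h2 : e v t = Real.exp (κ * t) • v ⟨t, ht⟩ := by
    simp only [e]
    rw [projIcc_of_mem hT ht]
  rw [h2, ← h1, smul_smul, key, one_smul]

end Volterra

/-! ### Weak derivatives on a time interval -/

theorem intervalIntegral_eq_integral_Ioo {X : Type*} [NormedAddCommGroup X] [NormedSpace ℝ X]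
    {a b : ℝ} (hab : a ≤ b) (f : ℝ → X) : ∫ s in a..b, f s = ∫ s in Ioo a b, f s := by
  rw [intervalIntegral.integral_of_le hab, integral_Ioc_eq_integral_Ioo]

theorem intervalIntegrable_of_integrableOn_Ioo {X : Type*} [NormedAddCommGroup X] {f : ℝ → X}
    {T : ℝ} (hf : IntegrableOn f (Ioo 0 T)) {a b : ℝ} (ha : a ∈ Icc 0 T) (hb : b ∈ Icc 0 T) :
    IntervalIntegrable f volume a b := by
  have h1 : IntegrableOn f (Icc 0 T) := (integrableOn_Icc_iff_integrableOn_Ioo).mpr hf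
  rw [intervalIntegrable_iff]
  exact h1.mono_set ((uIoc_subset_uIcc).trans (uIcc_subset_Icc ha hb))

theorem IsTestFunction.apply_left {a b : ℝ} {η : ℝ → ℝ} (hη : IsTestFunction a b η) : η a = 0 :=
  image_eq_zero_of_notMem_tsupport fun h => lt_irrefl a (hη.2.2 h).1

theorem IsTestFunction.apply_right {a b : ℝ} {η : ℝ → ℝ} (hη : IsTestFunction a b η) : η b = 0 :=
  image_eq_zero_of_notMem_tsupport fun h => lt_irrefl b (hη.2.2 h).2

theorem IsTestFunction.continuous_deriv {a b : ℝ} {η : ℝ → ℝ} (hη : IsTestFunction a b η) :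
    Continuous (deriv η) :=
  (contDiff_infty_iff_deriv.mp hη.1).2.continuous

theorem IsTestFunction.integral_deriv {a b : ℝ} {η : ℝ → ℝ} (hη : IsTestFunction a b η)
    (s t : ℝ) : ∫ x in s..t, deriv η x = η t - η s :=
  intervalIntegral.integral_deriv_eq_sub
    (fun _ _ => (contDiff_infty_iff_deriv.mp hη.1).1.differentiableAt)
    (hη.continuous_deriv.intervalIntegrable _ _)

/-- A primitive of an integrable function has this function as its weak derivative. -/
theorem hasWeakDeriv_primitive {X : Type*} [NormedAddCommGroup X] [NormedSpace ℝ X]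
    [CompleteSpace X] {T : ℝ} (hT : 0 ≤ T) {u v : ℝ → X} (c : X) (hv : IntegrableOn v (Ioo 0 T))
    (hu : ∀ t ∈ Icc 0 T, u t = c + ∫ s in (0 : ℝ)..t, v s) : HasWeakDeriv 0 T u v := by
  intro η hη
  have hvi : IntervalIntegrable v volume 0 T :=
    intervalIntegrable_of_integrableOn_Ioo hv (left_mem_Icc.mpr hT) (right_mem_Icc.mpr hT)
  rw [← intervalIntegral_eq_integral_Ioo hT, ← intervalIntegral_eq_integral_Ioo hT]
  have hpc : ContinuousOn (fun t => ∫ s in (0 : ℝ)..t, v s) (uIcc 0 T) :=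
    intervalIntegral.continuousOn_primitive_interval (by
      rw [uIcc_of_le hT]; exact (integrableOn_Icc_iff_integrableOn_Ioo).mpr hv)
  have h1 : ∫ t in (0 : ℝ)..T, deriv η t • u t
      = (∫ t in (0 : ℝ)..T, deriv η t • c)
        + ∫ t in (0 : ℝ)..T, deriv η t • ∫ s in (0 : ℝ)..t, v s := by
    rw [← intervalIntegral.integral_add]
    · refine intervalIntegral.integral_congr fun t ht => ?_
      rw [uIcc_of_le hT] at ht
      simp only [hu t ht, smul_add]
    · exact (hη.continuous_deriv.smul continuous_const).intervalIntegrable _ _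
    · exact (hη.continuous_deriv.continuousOn.smul hpc).intervalIntegrable
  -- Exchanging the integrals replaces `deriv η` by its integral from `s` to `T`, which equals `-η
  -- s`.
  have h2 := integral_bilin_primitive_swap (ContinuousLinearMap.lsmul ℝ ℝ : ℝ →L[ℝ] X →L[ℝ] X)
    hT (hη.continuous_deriv.intervalIntegrable 0 T) hvi
  simp only [ContinuousLinearMap.lsmul_apply] at h2
  rw [h1, h2, intervalIntegral.integral_smul_const, hη.integral_deriv, hη.apply_left,
    hη.apply_right, sub_zero, zero_smul, zero_add, ← intervalIntegral.integral_neg]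
  refine intervalIntegral.integral_congr fun s _ => ?_
  simp only [hη.integral_deriv, hη.apply_right, zero_sub, neg_smul]

/-- Continuous functions with vanishing weak derivative are constant. -/
theorem eq_of_hasWeakDeriv_zero {T : ℝ} (hT : 0 < T) {f : ℝ → ℝ} (hf : ContinuousOn f (Icc 0 T))
    (h : ∀ η, IsTestFunction 0 T η → ∫ s in Ioo (0 : ℝ) T, deriv η s * f s = 0) {t : ℝ}
    (ht : t ∈ Icc 0 T) : f t = f 0 := by
  have hmaps : MapsTo (fun x => T * x) (Icc 0 1) (Icc 0 T) := fun x hx =>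
    ⟨mul_nonneg hT.le hx.1, mul_le_of_le_one_right hT.le hx.2⟩
  have hgc : ContinuousOn (fun x => f (T * x)) (Icc 0 1) :=
    hf.comp (by fun_prop) hmaps
  -- The variable is rescaled by `T` to reduce to the interval `(0,1)`; test functions are rescaled
  -- by `T⁻¹`.
  obtain ⟨k, hk⟩ := ae_eq_const_of_weakDeriv_zero (f := fun x => f (T * x))
    ((hgc.integrableOn_compact isCompact_Icc).mono_set Ioo_subset_Icc_self) (by
      intro η hη
      have hd : Differentiable ℝ η := (contDiff_infty_iff_deriv.mp hη.1).1
      have hη' : IsTestFunction 0 T (fun s => η (T⁻¹ * s)) := by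
        have hts : tsupport (fun s => η (T⁻¹ * s)) ⊆ (fun s => T⁻¹ * s) ⁻¹' tsupport η :=
          tsupport_comp_subset_preimage η (by fun_prop)
        refine ⟨hη.1.comp (by fun_prop), ?_, fun s hs => ?_⟩
        · exact hη.2.1.comp_homeomorph (Homeomorph.mulLeft₀ T⁻¹ (inv_ne_zero hT.ne'))
        · have h1 := hη.2.2 (hts hs)
          have e : s = T * (T⁻¹ * s) := by field_simp
          rw [e]
          exact ⟨mul_pos hT h1.1, mul_lt_of_lt_one_right hT h1.2⟩
      have h1 := h _ hη'
      have hder : ∀ s, deriv (fun s => η (T⁻¹ * s)) s = T⁻¹ * deriv η (T⁻¹ * s) := fun s => by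
        have := ((hd (T⁻¹ * s)).hasDerivAt.comp s ((hasDerivAt_id s).const_mul T⁻¹))
        rw [mul_one] at this
        rw [mul_comm]
        exact this.deriv
      rw [← intervalIntegral_eq_integral_Ioo hT.le] at h1
      rw [← intervalIntegral_eq_integral_Ioo zero_le_one]
      simp only [hder] at h1
      have h2 := intervalIntegral.integral_comp_mul_left (a := 0) (b := 1)
        (fun s => T⁻¹ * deriv η (T⁻¹ * s) * f s) hT.ne'
      rw [mul_zero, mul_one, h1, smul_zero] at h2
      have h3 : ∀ x, T⁻¹ * (T * x) = x := fun x => by field_simp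
      simp only [h3, mul_assoc] at h2
      rw [intervalIntegral.integral_const_mul] at h2
      exact (mul_eq_zero.mp h2).resolve_left (inv_ne_zero hT.ne'))
  have hEq : EqOn (fun x => f (T * x)) (fun _ => k) (Icc 0 1) := by
    have h1 : EqOn (fun x => f (T * x)) (fun _ => k) (Ioo 0 1) :=
      Measure.eqOn_open_of_ae_eq hk isOpen_Ioo (hgc.mono Ioo_subset_Icc_self) continuousOn_const
    exact h1.of_subset_closure hgc continuousOn_const Ioo_subset_Icc_self
      (by rw [closure_Ioo (by norm_num)])
  have h0 := hEq (left_mem_Icc.mpr zero_le_one)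
  have h1 := hEq (x := T⁻¹ * t) ⟨mul_nonneg (inv_nonneg.mpr hT.le) ht.1, by
    rw [inv_mul_le_iff₀ hT, mul_one]; exact ht.2⟩
  simp only [mul_zero] at h0
  have e : T * (T⁻¹ * t) = t := by field_simp
  simp only [e] at h1
  rw [h0, h1]

theorem hasDerivWithinAt_primitive {X : Type*} [NormedAddCommGroup X] [NormedSpace ℝ X]
    [CompleteSpace X] {T : ℝ} {u v : ℝ → X} (hv : ContinuousOn v (Icc 0 T))
    (hu : ∀ t ∈ Icc 0 T, u t = u 0 + ∫ s in (0 : ℝ)..t, v s) {t : ℝ} (ht : t ∈ Icc 0 T) :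
    HasDerivWithinAt u (v t) (Icc 0 T) t := by
  have hT : 0 ≤ T := ht.1.trans ht.2
  -- Constant extension beyond `[0,T]` makes the two-sided fundamental theorem of calculus available
  -- at the endpoints.
  have hext : Continuous (IccExtend hT ((Icc 0 T).domRestrict v)) :=
    (continuousOn_iff_continuous_domRestrict.mp hv).Icc_extend'
  have heq : ∀ s ∈ Icc 0 T, IccExtend hT ((Icc 0 T).domRestrict v) s = v s := fun s hs => by
    rw [IccExtend_of_mem hT _ hs]; rfl
  have hd : HasDerivAt (fun t => u 0 + ∫ s in (0 : ℝ)..t, IccExtend hT ((Icc 0 T).domRestrict v) s)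
      (IccExtend hT ((Icc 0 T).domRestrict v) t) t :=
    (intervalIntegral.integral_hasDerivAt_right (hext.intervalIntegrable _ _)
      (hext.stronglyMeasurableAtFilter _ _) hext.continuousAt).const_add _
  rw [heq t ht] at hd
  refine hd.hasDerivWithinAt.congr (fun s hs => ?_) ?_
  · rw [hu s hs]
    congr 1
    refine intervalIntegral.integral_congr fun r hr => (heq r ?_).symm
    exact uIcc_subset_Icc (left_mem_Icc.mpr hT) hs hr
  · rw [hu t ht]
    congr 1
    refine intervalIntegral.integral_congr fun r hr => (heq r ?_).symm
    exact uIcc_subset_Icc (left_mem_Icc.mpr hT) ht hr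

/-- A continuous weak derivative of a continuous function is a classical derivative. -/
theorem HasWeakDeriv.hasDerivWithinAt {E : Type*} [NormedAddCommGroup E] [InnerProductSpace ℝ E]
    [CompleteSpace E] {T : ℝ} (hT : 0 < T) {u v : ℝ → E} (hu : ContinuousOn u (Icc 0 T))
    (hv : ContinuousOn v (Icc 0 T)) (h : HasWeakDeriv 0 T u v) {t : ℝ} (ht : t ∈ Icc 0 T) :
    HasDerivWithinAt u (v t) (Icc 0 T) t := by
  have hvI : IntegrableOn v (Ioo 0 T) :=
    (hv.integrableOn_compact isCompact_Icc).mono_set Ioo_subset_Icc_self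
  have huI : IntegrableOn u (Ioo 0 T) :=
    (hu.integrableOn_compact isCompact_Icc).mono_set Ioo_subset_Icc_self
  have hpc : ContinuousOn (fun t => ∫ s in (0 : ℝ)..t, v s) (Icc 0 T) := by
    have := intervalIntegral.continuousOn_primitive_interval (μ := volume) (a := 0) (b := T)
      (f := v) (by rw [uIcc_of_le hT.le]; exact hv.integrableOn_compact isCompact_Icc)
    rwa [uIcc_of_le hT.le] at this
  have hpI : IntegrableOn (fun t => ∫ s in (0 : ℝ)..t, v s) (Ioo 0 T) :=
    (hpc.integrableOn_compact isCompact_Icc).mono_set Ioo_subset_Icc_self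
  refine hasDerivWithinAt_primitive hv (fun s hs => ?_) ht
  -- Pairing with `x` reduces to a scalar function: `u` minus the primitive of `v` has zero weak
  -- derivative, hence is constant.
  refine ext_inner_right ℝ fun x => ?_
  have hw : HasWeakDeriv 0 T (fun t => ∫ s in (0 : ℝ)..t, v s) v :=
    hasWeakDeriv_primitive hT.le 0 hvI fun t _ => by rw [zero_add]
  have hd : ContinuousOn (fun t => ⟪u t - ∫ s in (0 : ℝ)..t, v s, x⟫) (Icc 0 T) :=
    (hu.sub hpc).inner continuousOn_const
  have key := eq_of_hasWeakDeriv_zero hT hd (fun η hη => by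
    have hbd : ∀ {f : ℝ → E}, IntegrableOn f (Ioo 0 T) →
        IntegrableOn (fun s => deriv η s • f s) (Ioo 0 T) := fun hf => by
      obtain ⟨C, hC⟩ := hη.2.1.deriv.exists_bound_of_continuous hη.continuous_deriv
      exact hf.bdd_smul C hη.continuous_deriv.aestronglyMeasurable
        (Eventually.of_forall hC)
    have h1 : ∫ s in Ioo (0 : ℝ) T, deriv η s • (u s - ∫ r in (0 : ℝ)..s, v r) = 0 := by
      simp only [smul_sub]
      rw [integral_sub (hbd huI) (hbd hpI), h η hη, hw η hη, sub_self]
    have h2 := ((innerSL ℝ).flip x).integral_comp_comm (hbd (huI.sub hpI))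
    simp only [Pi.sub_apply, h1, map_zero] at h2
    refine Eq.trans ?_ h2
    refine integral_congr_ae (Eventually.of_forall fun s => ?_)
    change _ = ⟪deriv η s • (u s - ∫ r in (0 : ℝ)..s, v r), x⟫
    rw [real_inner_smul_left]) hs
  simp only [intervalIntegral.integral_same, sub_zero, inner_sub_left] at key
  rw [inner_add_left]
  linarith

/-! ### The abstract wave equation -/

section AbstractWave

theorem norm_fst_le {H : Type*} [NormedAddCommGroup H] (x : WithLp 2 (H × H)) :
    ‖x.fst‖ ≤ ‖x‖ := by
  rw [WithLp.prod_norm_eq_of_L2]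
  exact Real.le_sqrt_of_sq_le (by nlinarith [sq_nonneg ‖x.snd‖])

theorem norm_snd_le {H : Type*} [NormedAddCommGroup H] (x : WithLp 2 (H × H)) :
    ‖x.snd‖ ≤ ‖x‖ := by
  rw [WithLp.prod_norm_eq_of_L2]
  exact Real.le_sqrt_of_sq_le (by nlinarith [sq_nonneg ‖x.fst‖])

variable {H : Type*} [NormedAddCommGroup H] [InnerProductSpace ℝ H]

/-- The embedding `x ↦ (x, 0)`. -/
def inlL (H : Type*) [NormedAddCommGroup H] [InnerProductSpace ℝ H] : H →L[ℝ] WithLp 2 (H × H) :=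
  (WithLp.prodContinuousLinearEquiv 2 ℝ H H).symm.toContinuousLinearMap.comp
    (ContinuousLinearMap.inl ℝ H H)

@[simp] theorem fst_inlL (x : H) : (inlL H x).fst = x := rfl

@[simp] theorem snd_inlL (x : H) : (inlL H x).snd = 0 := rfl

theorem norm_inlL (x : H) : ‖inlL H x‖ = ‖x‖ := by
  rw [WithLp.prod_norm_eq_of_L2]
  simp

theorem inner_inlL_left (x : H) (y : WithLp 2 (H × H)) : ⟪inlL H x, y⟫ = ⟪x, y.fst⟫ := by
  rw [WithLp.prod_inner_apply]
  change ⟪x, y.fst⟫ + ⟪(0 : H), y.snd⟫ = _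
  rw [inner_zero_left, add_zero]

/-- The source term `(f, 0)`, extended by zero outside `(0,T)`. -/
def source (T : ℝ) (f : ℝ → H) : ℝ → WithLp 2 (H × H) :=
  (Ioo 0 T).indicator fun t => inlL H (f t)

theorem integrable_source {T : ℝ} {f : ℝ → H} (hf : IntegrableOn f (Ioo 0 T)) :
    Integrable (source T f) :=
  (integrable_indicator_iff measurableSet_Ioo).mpr ((inlL H).integrable_comp hf)

theorem source_of_mem {T : ℝ} (f : ℝ → H) {t : ℝ} (ht : t ∈ Ioo 0 T) :
    source T f t = inlL H (f t) := indicator_of_mem ht _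

theorem norm_source_le (T : ℝ) (f : ℝ → H) (t : ℝ) : ‖source T f t‖ ≤ ‖f t‖ := by
  rw [source, ← norm_inlL (f t)]
  exact norm_indicator_le_norm_self _ _

variable [CompleteSpace H]

/-- The skew-adjoint operator `(φ, r) ↦ (-J r, J* φ)`, the inverse of the wave operator. -/
def waveOp (J : H →L[ℝ] H) : WithLp 2 (H × H) →L[ℝ] WithLp 2 (H × H) :=
  (WithLp.prodContinuousLinearEquiv 2 ℝ H H).symm.toContinuousLinearMap.comp
    ((-(J.comp (WithLp.sndL 2 ℝ H H))).prod ((J†).comp (WithLp.fstL 2 ℝ H H)))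

variable {J : H →L[ℝ] H}

@[simp] theorem fst_waveOp (x : WithLp 2 (H × H)) : (waveOp J x).fst = -J x.snd := rfl

@[simp] theorem snd_waveOp (x : WithLp 2 (H × H)) : (waveOp J x).snd = (J†) x.fst := rfl

theorem isSkew_waveOp (J : H →L[ℝ] H) : IsSkew (waveOp J) := by
  intro x y
  rw [WithLp.prod_inner_apply, WithLp.prod_inner_apply]
  change ⟪-J x.snd, y.fst⟫ + ⟪(J†) x.fst, y.snd⟫ = -(⟪x.fst, -J y.snd⟫ + ⟪x.snd, (J†) y.fst⟫)
  rw [inner_neg_left, inner_neg_right, ContinuousLinearMap.adjoint_inner_left,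
    ContinuousLinearMap.adjoint_inner_right]
  ring

theorem injective_waveOp (hJ : Function.Injective J) (hJ' : Function.Injective (J†)) :
    Function.Injective (waveOp J) := by
  rw [injective_iff_map_eq_zero]
  intro x hx
  have h1 : x.fst = 0 := hJ' (by
    rw [map_zero, ← snd_waveOp, hx]; rfl)
  have h2 : x.snd = 0 := hJ (by
    rw [map_zero, ← neg_eq_zero, ← fst_waveOp, hx]; rfl)
  rw [← norm_eq_zero, WithLp.prod_norm_eq_of_L2, h1, h2]
  simp

/-- A force enters the velocity equation only. After applying `B` it sits in the second component,
so it disturbs neither the identity `w' = wt` nor the first component at time lag zero. -/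
theorem fst_waveOp_source (T : ℝ) (f : ℝ → H) (t : ℝ) : (waveOp J (source T f t)).fst = 0 := by
  rw [fst_waveOp]
  by_cases ht : t ∈ Ioo 0 T
  · rw [source_of_mem f ht, snd_inlL, map_zero, neg_zero]
  · rw [source, indicator_of_notMem ht]
    simp

/-- The forward Duhamel term `∫₀ᵗ L^{-1/2} sin((t-s) L^{1/2}) G(s) ds`. -/
def duhamel (J : H →L[ℝ] H) (U : ℝ → WithLp 2 (H × H) →L[ℝ] WithLp 2 (H × H)) (T : ℝ) (G : ℝ → H)
    (t : ℝ) : H :=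
  (waveOp J (mild U 0 (source T G) t)).fst

/-- The initial value of the mild solution with source `F` vanishing at time `T`. -/
def backwardInit (U : ℝ → WithLp 2 (H × H) →L[ℝ] WithLp 2 (H × H)) (T : ℝ) (F : ℝ → H) :
    WithLp 2 (H × H) :=
  -∫ s in (0 : ℝ)..T, U (-s) (source T F s)

/-- The mild solution with source `F` vanishing at time `T`. -/
def backward (U : ℝ → WithLp 2 (H × H) →L[ℝ] WithLp 2 (H × H)) (T : ℝ) (F : ℝ → H) :
    ℝ → WithLp 2 (H × H) :=
  mild U (backwardInit U T F) (source T F)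

variable {U : ℝ → WithLp 2 (H × H) →L[ℝ] WithLp 2 (H × H)} {T : ℝ}

theorem continuous_duhamel (hU : IsUnitaryGroup (waveOp J) U) {G : ℝ → H}
    (hG : IntegrableOn G (Ioo 0 T)) : Continuous (duhamel J U T G) :=
  (WithLp.fstL 2 ℝ H H).continuous.comp
    ((waveOp J).continuous.comp (continuous_mild hU 0 (integrable_source hG)))

theorem waveOp_mild_zero (hU : IsUnitaryGroup (waveOp J) U) {G : ℝ → H}
    (hG : IntegrableOn G (Ioo 0 T)) (t : ℝ) :
    waveOp J (mild U 0 (source T G) t)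
      = ∫ s in (0 : ℝ)..t, U (t - s) (waveOp J (source T G s)) := by
  have hi := (hU.integrable_map_neg (integrable_source hG)).intervalIntegrable (a := 0) (b := t)
  have h1 := ((waveOp J).comp (U t)).intervalIntegral_comp_comm hi
  rw [mild, zero_add]
  refine h1.symm.trans (intervalIntegral.integral_congr fun s _ => ?_)
  change waveOp J (U t (U (-s) (source T G s))) = _
  rw [← hU.map_add, ← hU.comm, sub_eq_add_neg]

theorem duhamel_sub (hU : IsUnitaryGroup (waveOp J) U) {F G : ℝ → H}
    (hF : IntegrableOn F (Ioo 0 T)) (hG : IntegrableOn G (Ioo 0 T)) (t : ℝ) :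
    duhamel J U T F t - duhamel J U T G t = duhamel J U T (fun s => F s - G s) t := by
  have e : ∀ s, source T (fun s => F s - G s) s = source T F s - source T G s := fun s => by
    by_cases hs : s ∈ Ioo 0 T
    · rw [source_of_mem _ hs, source_of_mem _ hs, source_of_mem _ hs, map_sub]
    · simp [source, indicator_of_notMem hs]
  simp only [duhamel]
  rw [← WithLp.sub_fst, ← map_sub]
  congr 2
  simp only [mild, zero_add, e, map_sub]
  rw [intervalIntegral.integral_sub
    (hU.integrable_map_neg (integrable_source hF)).intervalIntegrable
    (hU.integrable_map_neg (integrable_source hG)).intervalIntegrable, map_sub]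

/-- At lag zero the integrand `U (t - s) (B f)` has vanishing first component. Subtracting `B f`
therefore changes nothing there, and the difference is at most `(t - s) ‖f‖` by
`norm_comm_apply_sub_le`. This is the bound `|sin (τ λ)| / λ ≤ τ` without spectral calculus. -/
theorem norm_duhamel_le (hU : IsUnitaryGroup (waveOp J) U) {G : ℝ → H}
    (hG : IntegrableOn G (Ioo 0 T)) {t : ℝ} (ht : t ∈ Icc 0 T) :
    ‖duhamel J U T G t‖ ≤ ∫ s in (0 : ℝ)..t, (t - s) * ‖G s‖ := by
  have hsrc := integrable_source hG
  have hcont : Integrable fun s => U (t - s) (waveOp J (source T G s)) := by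
    have h2 := (((waveOp J).comp (U t)).integrable_comp (hU.integrable_map_neg hsrc))
    refine h2.congr (Eventually.of_forall fun s => ?_)
    change waveOp J (U t (U (-s) (source T G s))) = U (t - s) (waveOp J (source T G s))
    rw [← hU.map_add, ← hU.comm, sub_eq_add_neg]
  have e : duhamel J U T G t
      = ∫ s in (0 : ℝ)..t, (U (t - s) (waveOp J (source T G s))).fst := by
    rw [duhamel, waveOp_mild_zero hU hG]
    exact ((WithLp.fstL 2 ℝ H H).intervalIntegral_comp_comm hcont.intervalIntegrable).symm
  rw [e]
  have hGi : IntervalIntegrable G volume 0 t :=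
    intervalIntegrable_of_integrableOn_Ioo hG ⟨le_rfl, ht.1.trans ht.2⟩ ht
  refine intervalIntegral.norm_integral_le_of_norm_le ht.1
    (Eventually.of_forall fun s hs => ?_)
    (hGi.norm.continuousOn_mul (by fun_prop))
  have h1 : (U (t - s) (waveOp J (source T G s))).fst
      = (U (t - s) (waveOp J (source T G s)) - waveOp J (source T G s)).fst := by
    rw [WithLp.sub_fst, fst_waveOp_source, sub_zero]
  rw [h1]
  refine (norm_fst_le _).trans ((hU.norm_comm_apply_sub_le _ _).trans ?_)
  rw [abs_of_nonneg (by linarith [hs.2]), mul_comm]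
  exact mul_le_mul_of_nonneg_left (norm_source_le T G s) (by linarith [hs.2])

/-! ### Backward mild solutions: duality and weak formulation. -/

theorem backward_eq (hU : IsUnitaryGroup (waveOp J) U) {F : ℝ → H}
    (hF : IntegrableOn F (Ioo 0 T)) (t : ℝ) :
    backward U T F t = -U t (∫ s in t..T, U (-s) (source T F s)) := by
  have hi := hU.integrable_map_neg (integrable_source hF)
  rw [backward, mild, backwardInit, ← map_neg,
    ← intervalIntegral.integral_add_adjacent_intervals (b := t) hi.intervalIntegrable
      hi.intervalIntegrable]
  congr 1
  abel

theorem backward_final (hU : IsUnitaryGroup (waveOp J) U) {F : ℝ → H}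
    (hF : IntegrableOn F (Ioo 0 T)) : backward U T F T = 0 := by
  rw [backward_eq hU hF, intervalIntegral.integral_same, map_zero, neg_zero]

theorem backward_zero (hU : IsUnitaryGroup (waveOp J) U) (F : ℝ → H) :
    backward U T F 0 = backwardInit U T F := mild_zero hU _ _

theorem continuous_backward (hU : IsUnitaryGroup (waveOp J) U) {F : ℝ → H}
    (hF : IntegrableOn F (Ioo 0 T)) : Continuous (backward U T F) :=
  continuous_mild hU _ (integrable_source hF)

/-- The backward and the forward solution operators are adjoint to each other. -/
theorem integral_inner_backward (hU : IsUnitaryGroup (waveOp J) U) (hT : 0 ≤ T) {F G : ℝ → H}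
    (hF : IntegrableOn F (Ioo 0 T)) (hG : IntegrableOn G (Ioo 0 T)) :
    ∫ t in Ioo 0 T, ⟪G t, (waveOp J (backward U T F t)).fst⟫
      = ∫ t in Ioo 0 T, ⟪F t, duhamel J U T G t⟫ := by
  have hf := hU.integrable_map_neg (integrable_source hF)
  have hg := (waveOp J).integrable_comp (hU.integrable_map_neg (integrable_source hG))
  have h := integral_bilin_primitive_swap (innerSL ℝ) (f := fun s => U (-s) (source T F s))
    (g := fun s => waveOp J (U (-s) (source T G s))) hT hf.intervalIntegrable
    hg.intervalIntegrable
  rw [intervalIntegral_eq_integral_Ioo hT, intervalIntegral_eq_integral_Ioo hT] at h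
  refine Eq.trans ?_ (h.symm.trans ?_)
  · refine setIntegral_congr_fun measurableSet_Ioo fun t ht => ?_
    change _ = ⟪∫ s in t..T, U (-s) (source T F s), waveOp J (U (-t) (source T G t))⟫
    rw [← inner_inlL_left, real_inner_comm, isSkew_waveOp, backward_eq hU hF, inner_neg_left,
      neg_neg, hU.inner_map_left, hU.comm, source_of_mem G ht]
  · refine setIntegral_congr_fun measurableSet_Ioo fun t ht => ?_
    change ⟪U (-t) (source T F t), ∫ s in (0 : ℝ)..t, waveOp J (U (-s) (source T G s))⟫ = _
    rw [hU.inner_map_left, neg_neg, source_of_mem F ht, inner_inlL_left, duhamel, mild, zero_add,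
      ← hU.comm]
    congr 3
    exact (waveOp J).intervalIntegral_comp_comm
      (hU.integrable_map_neg (integrable_source hG)).intervalIntegrable

/-- Since `U t` has adjoint `U (-t)`, the free evolution passes onto the source, and what appears is
the integral defining `backwardInit`. -/
theorem integral_inner_free (hU : IsUnitaryGroup (waveOp J) U) (hT : 0 ≤ T) {F : ℝ → H}
    (hF : IntegrableOn F (Ioo 0 T)) (X : WithLp 2 (H × H)) :
    ∫ t in Ioo 0 T, ⟪F t, (U t X).fst⟫ = -⟪X, backward U T F 0⟫ := by
  have hf := hU.integrable_map_neg (integrable_source hF)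
  rw [backward_zero hU, backwardInit, inner_neg_right, neg_neg]
  have h1 := (innerSL ℝ X).intervalIntegral_comp_comm (hf.intervalIntegrable (a := 0) (b := T))
  refine Eq.trans ?_ h1
  rw [intervalIntegral_eq_integral_Ioo hT]
  refine setIntegral_congr_fun measurableSet_Ioo fun t ht => ?_
  change _ = ⟪X, U (-t) (source T F t)⟫
  rw [← hU.inner_map_left, source_of_mem F ht, real_inner_comm (inlL H (F t)), inner_inlL_left]

theorem waveOp_backward (hU : IsUnitaryGroup (waveOp J) U) {F : ℝ → H}
    (hF : IntegrableOn F (Ioo 0 T)) {t : ℝ} (ht : 0 ≤ t) :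
    waveOp J (backward U T F t) = waveOp J (backward U T F 0)
      + ∫ s in (0 : ℝ)..t, (backward U T F s + waveOp J (source T F s)) := by
  rw [backward_zero hU]
  exact map_mild hU (isSkew_waveOp J) _ (integrable_source hF) ht

theorem hasDerivWithinAt_fst_waveOp_backward (hU : IsUnitaryGroup (waveOp J) U) {F : ℝ → H}
    (hF : IntegrableOn F (Ioo 0 T)) {t : ℝ} (ht : t ∈ Icc 0 T) :
    HasDerivWithinAt (fun s => (waveOp J (backward U T F s)).fst) (backward U T F t).fst
      (Icc 0 T) t := by
  have hc := continuous_backward hU hF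
  refine hasDerivWithinAt_primitive
    (((WithLp.fstL 2 ℝ H H).continuous.comp hc).continuousOn) (fun s hs => ?_) ht
  have hi : IntervalIntegrable (fun s => backward U T F s + waveOp J (source T F s)) volume 0 s :=
    (hc.intervalIntegrable _ _).add
      ((waveOp J).integrable_comp (integrable_source hF)).intervalIntegrable
  rw [waveOp_backward hU hF hs.1, WithLp.add_fst]
  congr 1
  refine ((WithLp.fstL 2 ℝ H H).intervalIntegral_comp_comm hi).symm.trans
    (intervalIntegral.integral_congr fun r _ => ?_)
  change (backward U T F r + waveOp J (source T F r)).fst = (backward U T F r).fst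
  rw [WithLp.add_fst, fst_waveOp_source, add_zero]

/-- Here the source does contribute, through `J† F`. It is only integrable, so the second component
has a weak time derivative, whereas the first is classically differentiable. -/
theorem snd_waveOp_backward (hU : IsUnitaryGroup (waveOp J) U) {F : ℝ → H}
    (hF : IntegrableOn F (Ioo 0 T)) {t : ℝ} (ht : t ∈ Icc 0 T) :
    (waveOp J (backward U T F t)).snd = (waveOp J (backward U T F 0)).snd
      + ∫ s in (0 : ℝ)..t, ((backward U T F s).snd + (J†) (F s)) := by
  have hc := continuous_backward hU hF
  have hi : IntervalIntegrable (fun s => backward U T F s + waveOp J (source T F s)) volume 0 t :=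
    (hc.intervalIntegrable _ _).add
      ((waveOp J).integrable_comp (integrable_source hF)).intervalIntegrable
  rw [waveOp_backward hU hF ht.1, WithLp.add_snd]
  congr 1
  refine ((WithLp.sndL 2 ℝ H H).intervalIntegral_comp_comm hi).symm.trans ?_
  rw [intervalIntegral_eq_integral_Ioo ht.1, intervalIntegral_eq_integral_Ioo ht.1]
  refine setIntegral_congr_fun measurableSet_Ioo fun s hs => ?_
  change (backward U T F s + waveOp J (source T F s)).snd = _
  rw [WithLp.add_snd, source_of_mem F ⟨hs.1, hs.2.trans_le ht.2⟩]
  rfl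

theorem integrableOn_backward_rhs (hU : IsUnitaryGroup (waveOp J) U) {F : ℝ → H}
    (hF : IntegrableOn F (Ioo 0 T)) :
    IntegrableOn (fun s => (backward U T F s).snd + (J†) (F s)) (Ioo 0 T) := by
  have hc : Continuous fun s => (backward U T F s).snd :=
    (WithLp.sndL 2 ℝ H H).continuous.comp (continuous_backward hU hF)
  exact ((hc.continuousOn.integrableOn_compact isCompact_Icc).mono_set Ioo_subset_Icc_self).add
    ((J†).integrable_comp hF)

theorem hasWeakDeriv_adjoint_fst_backward (hU : IsUnitaryGroup (waveOp J) U) (hT : 0 ≤ T)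
    {F : ℝ → H} (hF : IntegrableOn F (Ioo 0 T)) :
    HasWeakDeriv 0 T (fun s => (J†) (backward U T F s).fst)
      (fun s => (backward U T F s).snd + (J†) (F s)) :=
  hasWeakDeriv_primitive hT _ (integrableOn_backward_rhs hU hF)
    fun _ ht => snd_waveOp_backward hU hF ht

theorem HasWeakDeriv.sub {X : Type*} [NormedAddCommGroup X] [NormedSpace ℝ X]
    {u₁ u₂ v₁ v₂ : ℝ → X} (h₁ : HasWeakDeriv 0 T u₁ v₁) (h₂ : HasWeakDeriv 0 T u₂ v₂)
    (hu₁ : IntegrableOn u₁ (Ioo 0 T)) (hu₂ : IntegrableOn u₂ (Ioo 0 T))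
    (hv₁ : IntegrableOn v₁ (Ioo 0 T)) (hv₂ : IntegrableOn v₂ (Ioo 0 T)) :
    HasWeakDeriv 0 T (fun t => u₁ t - u₂ t) (fun t => v₁ t - v₂ t) := by
  intro η hη
  have hd : ∀ {f : ℝ → X}, IntegrableOn f (Ioo 0 T) →
      IntegrableOn (fun s => deriv η s • f s) (Ioo 0 T) := fun hf => by
    obtain ⟨C, hC⟩ := hη.2.1.deriv.exists_bound_of_continuous hη.continuous_deriv
    exact hf.bdd_smul C hη.continuous_deriv.aestronglyMeasurable (Eventually.of_forall hC)
  have h0 : ∀ {f : ℝ → X}, IntegrableOn f (Ioo 0 T) →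
      IntegrableOn (fun s => η s • f s) (Ioo 0 T) := fun hf => by
    obtain ⟨C, hC⟩ := hη.2.1.exists_bound_of_continuous hη.1.continuous
    exact hf.bdd_smul C hη.1.continuous.aestronglyMeasurable (Eventually.of_forall hC)
  simp only [smul_sub]
  rw [integral_sub (hd hu₁) (hd hu₂), integral_sub (h0 hv₁) (h0 hv₂), h₁ η hη, h₂ η hη]
  abel

/-- A weak solution of the backward problem is the mild one. -/
theorem eq_backward_of_hasWeakDeriv (hU : IsUnitaryGroup (waveOp J) U)
    (hinj : Function.Injective (waveOp J)) (hT : 0 < T) {F p q : ℝ → H}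
    (hF : IntegrableOn F (Ioo 0 T)) (hp : ContinuousOn p (Icc 0 T)) (hq : ContinuousOn q (Icc 0 T))
    (hd : ∀ t ∈ Icc 0 T, HasDerivWithinAt (fun s => J (q s)) (p t) (Icc 0 T) t)
    (hw : HasWeakDeriv 0 T (fun t => (J†) (p t)) (fun t => -q t + (J†) (F t)))
    (hpT : p T = 0) (hqT : q T = 0) {t : ℝ} (ht : t ∈ Icc 0 T) :
    p t = (backward U T F t).fst ∧ -q t = (backward U T F t).snd := by
  have hbc := continuous_backward hU hF
  have hfc : Continuous fun s => (backward U T F s).fst :=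
    (WithLp.fstL 2 ℝ H H).continuous.comp hbc
  have hsc : Continuous fun s => (backward U T F s).snd :=
    (WithLp.sndL 2 ℝ H H).continuous.comp hbc
  have hcI : ∀ {f : ℝ → H}, ContinuousOn f (Icc 0 T) → IntegrableOn f (Ioo 0 T) := fun hf =>
    (hf.integrableOn_compact isCompact_Icc).mono_set Ioo_subset_Icc_self
  -- In the difference the sources cancel. Its weak derivative is thus continuous, hence classical,
  -- and conservation of `‖B D‖` applies.
  let D : ℝ → WithLp 2 (H × H) := fun s =>
    (WithLp.prodContinuousLinearEquiv 2 ℝ H H).symm (p s, -q s) - backward U T F s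
  have hDf : ∀ s, (D s).fst = p s - (backward U T F s).fst := fun s => rfl
  have hDs : ∀ s, (D s).snd = -q s - (backward U T F s).snd := fun s => rfl
  have hfstd : ∀ s ∈ Icc 0 T, HasDerivWithinAt (fun s => (waveOp J (D s)).fst) (D s).fst
      (Icc 0 T) s := by
    intro s hs
    refine ((hd s hs).sub (hasDerivWithinAt_fst_waveOp_backward hU hF hs)).congr_of_mem
      (fun r _ => ?_) hs
    rw [fst_waveOp, hDs, map_sub, map_neg]
    change _ = J (q r) - (waveOp J (backward U T F r)).fst
    rw [fst_waveOp]
    abel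
  have hsndd : ∀ s ∈ Icc 0 T, HasDerivWithinAt (fun s => (waveOp J (D s)).snd) (D s).snd
      (Icc 0 T) s := by
    intro s hs
    have h1 := hw.sub (hasWeakDeriv_adjoint_fst_backward hU hT.le hF)
      ((J†).integrable_comp (hcI hp)) (hcI ((J†).continuous.comp hfc).continuousOn)
      ((hcI hq.neg).add ((J†).integrable_comp hF)) (integrableOn_backward_rhs hU hF)
    have e1 : (fun t => (J†) (p t) - (J†) (backward U T F t).fst)
        = fun s => (waveOp J (D s)).snd := by
      ext1 r
      rw [snd_waveOp, hDf, map_sub]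
    have e2 : (fun t => -q t + (J†) (F t) - ((backward U T F t).snd + (J†) (F t)))
        = fun s => (D s).snd := by
      ext1 r
      rw [hDs]
      abel
    rw [e1, e2] at h1
    refine h1.hasDerivWithinAt hT ?_ ?_ hs
    · exact (J†).continuous.comp_continuousOn (hp.sub hfc.continuousOn)
    · exact hq.neg.sub hsc.continuousOn
  have hDd : ∀ s ∈ Icc 0 T, HasDerivWithinAt (fun s => waveOp J (D s)) (D s) (Icc 0 T) s := by
    intro s hs
    have h1 := (hfstd s hs).prodMk (hsndd s hs)
    exact (WithLp.prodContinuousLinearEquiv 2 ℝ H H).symm.toContinuousLinearMap.hasFDerivAt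
      |>.comp_hasDerivWithinAt s h1
  have hDT : D T = 0 := by
    simp only [D]
    rw [backward_final hU hF, hpT, hqT, neg_zero, sub_zero]
    rfl
  have hD0 := (isSkew_waveOp J).eq_zero_of_hasDerivWithinAt hinj hDd hDT ht
  constructor
  · rw [← sub_eq_zero, ← hDf, hD0]; rfl
  · rw [← sub_eq_zero, ← hDs, hD0]; rfl

end AbstractWave

/-! ### The abstract wave equation with a potential -/

section Potential

variable {H : Type*} [NormedAddCommGroup H] [InnerProductSpace ℝ H]

theorem integrable_inner_of_memLp {α : Type*} [MeasurableSpace α] {μ : Measure α} {f g : α → H}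
    (hf : MemLp f 2 μ) (hg : MemLp g 2 μ) : Integrable (fun t => ⟪f t, g t⟫) μ :=
  (hf.norm.integrable_mul hg.norm).mono' (hf.1.inner hg.1)
    (Eventually.of_forall fun _ => norm_inner_le_norm _ _)

theorem memLp_of_continuousOn {H : Type*} [NormedAddCommGroup H] {T : ℝ} {f : ℝ → H} (hf : ContinuousOn f (Icc 0 T)) :
    MemLp f 2 (volTime T) := by
  obtain ⟨C, hC⟩ := isCompact_Icc.exists_bound_of_continuousOn hf
  refine MemLp.of_bound ((hf.mono Ioo_subset_Icc_self).aestronglyMeasurable measurableSet_Ioo) C ?_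
  filter_upwards [ae_restrict_mem measurableSet_Ioo] with t ht
  exact hC t (Ioo_subset_Icc_self ht)

/-- A measurable family of symmetric operators, bounded by `M`. -/
structure IsPotential (m : ℝ → H →L[ℝ] H) (M : ℝ) : Prop where
  symm : ∀ t x y, ⟪m t x, y⟫ = ⟪x, m t y⟫
  norm_le : ∀ t x, ‖m t x‖ ≤ M * ‖x‖
  stronglyMeasurable : ∀ x, StronglyMeasurable fun t => m t x

/-- The map `(x, t) ↦ m t x` is continuous in `x` and measurable in `t`, hence jointly measurable
because `H` is second countable. -/
theorem IsPotential.memLp [SecondCountableTopology H] {m : ℝ → H →L[ℝ] H} {M : ℝ}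
    (hm : IsPotential m M) {μ : Measure ℝ} {u : ℝ → H} (hu : MemLp u 2 μ) :
    MemLp (fun t => m t (u t)) 2 μ := by
  borelize H
  have h1 : StronglyMeasurable (Function.uncurry fun (x : H) (t : ℝ) => m t x) :=
    stronglyMeasurable_uncurry_of_continuous_of_stronglyMeasurable
      (fun t => (m t).continuous) hm.stronglyMeasurable
  have h2 : AEStronglyMeasurable (fun t => m t (u t)) μ :=
    (h1.comp_measurable measurable_id).aestronglyMeasurable.comp_aemeasurable
      (hu.1.aemeasurable.prodMk aemeasurable_id)
  exact hu.of_le_mul h2 (Eventually.of_forall fun t => hm.norm_le t (u t))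

variable [CompleteSpace H] {J : H →L[ℝ] H}
  {U : ℝ → WithLp 2 (H × H) →L[ℝ] WithLp 2 (H × H)} {T M : ℝ} {m : ℝ → H →L[ℝ] H}

/-- The time derivative of the solution of the Duhamel equation with right-hand side `-G`,
in the dual space. -/
def duhamelDeriv (J : H →L[ℝ] H) (U : ℝ → WithLp 2 (H × H) →L[ℝ] WithLp 2 (H × H)) (T : ℝ)
    (X : WithLp 2 (H × H)) (G : ℝ → H) (t : ℝ) : H :=
  (U t X).snd - (waveOp J (mild U 0 (source T G) t)).snd

theorem continuous_duhamelDeriv (hU : IsUnitaryGroup (waveOp J) U) {G : ℝ → H}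
    (hG : IntegrableOn G (Ioo 0 T)) (X : WithLp 2 (H × H)) :
    Continuous (duhamelDeriv J U T X G) := by
  refine Continuous.sub ((WithLp.sndL 2 ℝ H H).continuous.comp (hU.continuous X)) ?_
  exact (WithLp.sndL 2 ℝ H H).continuous.comp
    ((waveOp J).continuous.comp (continuous_mild hU 0 (integrable_source hG)))

/-- The embedding of `H` into the dual is `J†`, and `J†` of a first component is the second
component of `B`. Applying `B` thus turns both terms into curves whose derivative is known; the
source drops out by `fst_waveOp_source`. -/
theorem hasDerivWithinAt_adjoint_duhamel (hU : IsUnitaryGroup (waveOp J) U) {G : ℝ → H}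
    (hG : IntegrableOn G (Ioo 0 T)) (X : WithLp 2 (H × H)) {t : ℝ} (ht : t ∈ Icc 0 T) :
    HasDerivWithinAt (fun s => (J†) ((U s X).fst - duhamel J U T G s))
      (duhamelDeriv J U T X G t) (Icc 0 T) t := by
  have hsrc := integrable_source hG
  have hmc := continuous_mild hU 0 hsrc
  have h1 : HasDerivWithinAt (fun s => (J†) (U s X).fst) (U t X).snd (Icc 0 T) t := by
    have h := (WithLp.sndL 2 ℝ H H).hasFDerivAt.comp_hasDerivAt t (hU.hasDerivAt X t)
    refine (h.congr_of_eventuallyEq (Eventually.of_forall fun s => ?_)).hasDerivWithinAt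
    change _ = (U s (waveOp J X)).snd
    rw [hU.comm, snd_waveOp]
  have h2 : HasDerivWithinAt (fun s => (J†) (duhamel J U T G s))
      (waveOp J (mild U 0 (source T G) t)).snd (Icc 0 T) t := by
    refine hasDerivWithinAt_primitive (v := fun s => (waveOp J (mild U 0 (source T G) s)).snd)
      (((WithLp.sndL 2 ℝ H H).continuous.comp ((waveOp J).continuous.comp hmc)).continuousOn)
      (fun s hs => ?_) ht
    have e0 : duhamel J U T G 0 = 0 := by
      rw [duhamel, mild_zero hU, map_zero]; rfl
    rw [e0, map_zero, zero_add, duhamel, ← snd_waveOp,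
      map_mild hU (isSkew_waveOp J) 0 hsrc hs.1, map_zero, zero_add]
    have hi : IntervalIntegrable (fun r => mild U 0 (source T G) r + waveOp J (source T G r))
        volume 0 s :=
      (hmc.intervalIntegrable _ _).add ((waveOp J).integrable_comp hsrc).intervalIntegrable
    refine (((WithLp.sndL 2 ℝ H H).comp (waveOp J)).intervalIntegral_comp_comm hi).symm.trans
      (intervalIntegral.integral_congr fun r _ => ?_)
    change (waveOp J (mild U 0 (source T G) r + waveOp J (source T G r))).snd = _
    rw [snd_waveOp, WithLp.add_fst, fst_waveOp_source, add_zero]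
    rfl
  simp only [map_sub]
  exact h1.sub h2

theorem norm_duhamelDeriv_le (hU : IsUnitaryGroup (waveOp J) U) (hJ : ‖J‖ ≤ 1) {G : ℝ → H}
    (X : WithLp 2 (H × H)) {b : ℝ}
    (hb : ∀ s ∈ Icc 0 T, ‖G s‖ ≤ b) {t : ℝ} (ht : t ∈ Icc 0 T) :
    ‖duhamelDeriv J U T X G t‖ ≤ ‖X‖ + b * T := by
  have hb0 : 0 ≤ b := (norm_nonneg _).trans (hb t ht)
  refine (norm_sub_le _ _).trans (add_le_add ((norm_snd_le _).trans (hU.norm_map t X).le) ?_)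
  rw [snd_waveOp]
  have h1 : ‖mild U 0 (source T G) t‖ ≤ b * T := by
    rw [mild, hU.norm_map, zero_add]
    have := intervalIntegral.norm_integral_le_of_norm_le_const (a := 0) (b := t) (C := b)
      (f := fun s => U (-s) (source T G s)) (fun s hs => by
        rw [uIoc_of_le ht.1] at hs
        rw [hU.norm_map]
        exact (norm_source_le T G s).trans (hb s ⟨hs.1.le, hs.2.trans ht.2⟩))
    rw [sub_zero, abs_of_nonneg ht.1] at this
    exact this.trans (by gcongr; exact ht.2)
  have h2 : ‖J†‖ ≤ 1 := by rwa [LinearIsometryEquiv.norm_map]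
  calc ‖(J†) (mild U 0 (source T G) t).fst‖ ≤ ‖J†‖ * ‖(mild U 0 (source T G) t).fst‖ :=
        (J†).le_opNorm _
    _ ≤ 1 * ‖mild U 0 (source T G) t‖ := by gcongr; exact norm_fst_le _
    _ ≤ b * T := by rwa [one_mul]

theorem memLp_fst_waveOp_backward (hU : IsUnitaryGroup (waveOp J) U) {F : ℝ → H}
    (hF : IntegrableOn F (Ioo 0 T)) :
    MemLp (fun t => (waveOp J (backward U T F t)).fst) 2 (volTime T) :=
  memLp_of_continuousOn ((WithLp.fstL 2 ℝ H H).continuous.comp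
    ((waveOp J).continuous.comp (continuous_backward hU hF))).continuousOn

variable [SecondCountableTopology H]

theorem IsPotential.norm_duhamel_le (hm : IsPotential m M) (hU : IsUnitaryGroup (waveOp J) U)
    {u : ℝ → H} (hu : Continuous u) {t : ℝ} (ht : t ∈ Icc 0 T) :
    ‖duhamel J U T (fun s => m s (u s)) t‖ ≤ M * ∫ s in (0 : ℝ)..t, (t - s) * ‖u s‖ := by
  have hi : IntegrableOn (fun s => m s (u s)) (Ioo 0 T) :=
    (hm.memLp (memLp_of_continuousOn hu.continuousOn)).integrable one_le_two
  refine (WaveTransposition.norm_duhamel_le hU hi ht).trans ?_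
  rw [← intervalIntegral.integral_const_mul]
  have hi' := intervalIntegrable_of_integrableOn_Ioo hi ⟨le_rfl, ht.1.trans ht.2⟩ ht
  refine intervalIntegral.integral_mono_on ht.1 (hi'.norm.continuousOn_mul (by fun_prop))
    (Continuous.intervalIntegrable (by fun_prop) _ _) fun s hs => ?_
  have h0 : 0 ≤ t - s := by linarith [hs.2]
  calc _ ≤ (t - s) * (M * ‖u s‖) := by gcongr; exact hm.norm_le s (u s)
    _ = _ := by ring

/-- Existence of the solution of the Duhamel equation, with its bound. -/
theorem IsPotential.exists_solution (hm : IsPotential m M) (hM : 0 ≤ M)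
    (hU : IsUnitaryGroup (waveOp J) U) (hT : 0 ≤ T) (X : WithLp 2 (H × H)) :
    ∃ u : ℝ → H, Continuous u ∧
      (∀ t ∈ Icc 0 T, u t = (U t X).fst - duhamel J U T (fun s => m s (u s)) t) ∧
      ∀ t ∈ Icc 0 T, ‖u t‖ ≤ 4 / 3 * ‖X‖ * Real.exp (2 * √M * t) := by
  have hi : ∀ {u : ℝ → H}, Continuous u → IntegrableOn (fun s => m s (u s)) (Ioo 0 T) := fun hu =>
    (hm.memLp (memLp_of_continuousOn hu.continuousOn)).integrable one_le_two
  obtain ⟨u, huc, hu⟩ := exists_volterra_solution (h := fun t => (U t X).fst) hT hM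
    (fun u => duhamel J U T (fun s => m s (u s)))
    (fun f hf => continuous_duhamel hU (hi hf))
    (fun f g hf hg t ht => by
      rw [duhamel_sub hU (hi hf) (hi hg)]
      simp only [← map_sub]
      exact hm.norm_duhamel_le hU (hf.sub hg) ht)
    ((WithLp.fstL 2 ℝ H H).continuous.comp (hU.continuous X))
  refine ⟨u, huc, hu, fun t ht => norm_le_of_volterra huc hM (norm_nonneg X) (fun s hs => ?_) ht⟩
  rw [hu s hs]
  refine (norm_sub_le _ _).trans (add_le_add ?_ (hm.norm_duhamel_le hU huc hs))
  exact (norm_fst_le _).trans (hU.norm_map s X).le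

/-- Duality between the backward problem and the Duhamel equation. -/
theorem IsPotential.integral_inner_backward (hm : IsPotential m M)
    (hU : IsUnitaryGroup (waveOp J) U) (hT : 0 ≤ T) {u F : ℝ → H} (hu : MemLp u 2 (volTime T))
    (hF : MemLp F 2 (volTime T)) :
    ∫ t in Ioo 0 T, ⟪u t, F t + m t (waveOp J (backward U T F t)).fst⟫
      = ∫ t in Ioo 0 T, ⟪F t, u t + duhamel J U T (fun s => m s (u s)) t⟫ := by
  have hFi : IntegrableOn F (Ioo 0 T) := hF.integrable one_le_two
  have hw := memLp_fst_waveOp_backward hU hFi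
  have hmu := hm.memLp hu
  have hmui : IntegrableOn (fun s => m s (u s)) (Ioo 0 T) := hmu.integrable one_le_two
  have hd : MemLp (duhamel J U T fun s => m s (u s)) 2 (volTime T) :=
    memLp_of_continuousOn (continuous_duhamel hU hmui).continuousOn
  simp only [inner_add_right]
  rw [integral_add (integrable_inner_of_memLp hu hF) (integrable_inner_of_memLp hu (hm.memLp hw)),
    integral_add (integrable_inner_of_memLp hF hu) (integrable_inner_of_memLp hF hd),
    ← WaveTransposition.integral_inner_backward hU hT hFi hmui]
  simp only [← hm.symm, real_inner_comm]

/-- The transposition identity. -/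
theorem IsPotential.integral_inner_solution (hm : IsPotential m M)
    (hU : IsUnitaryGroup (waveOp J) U) (hT : 0 ≤ T) {X : WithLp 2 (H × H)} {u F : ℝ → H}
    (huc : Continuous u)
    (hu : ∀ t ∈ Icc 0 T, u t = (U t X).fst - duhamel J U T (fun s => m s (u s)) t)
    (hF : MemLp F 2 (volTime T)) :
    ∫ t in Ioo 0 T, ⟪u t, F t + m t (waveOp J (backward U T F t)).fst⟫
      = -⟪X, backward U T F 0⟫ := by
  rw [hm.integral_inner_backward hU hT (memLp_of_continuousOn huc.continuousOn) hF,
    ← integral_inner_free hU hT (hF.integrable one_le_two)]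
  refine setIntegral_congr_fun measurableSet_Ioo fun t ht => ?_
  have := hu t (Ioo_subset_Icc_self ht)
  rw [eq_sub_iff_add_eq.mp this]

/-- Uniqueness in the transposition identity. -/
theorem IsPotential.ae_eq_zero_of_forall_integral_inner (hm : IsPotential m M) (hM : 0 ≤ M)
    (hU : IsUnitaryGroup (waveOp J) U) (hT : 0 ≤ T) {ψ : ℝ → H} (hψ : MemLp ψ 2 (volTime T))
    (h : ∀ F : ℝ → H, MemLp F 2 (volTime T) →
      ∫ t in Ioo 0 T, ⟪ψ t, F t + m t (waveOp J (backward U T F t)).fst⟫ = 0) :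
    ∀ᵐ t ∂volTime T, ψ t = 0 := by
  have hmψ : IntegrableOn (fun s => m s (ψ s)) (Ioo 0 T) :=
    (hm.memLp hψ).integrable one_le_two
  -- By duality the hypothesis says that `ψ + v` is orthogonal to every `F`. The choice `F = ψ + v`
  -- gives `ψ = -v` almost everywhere, and then `v` solves the homogeneous Volterra equation, so
  -- Gronwall applies with `a = 0`.
  set v := duhamel J U T (fun s => m s (ψ s)) with hv
  have hvc : Continuous v := continuous_duhamel hU hmψ
  have hF : MemLp (fun t => ψ t + v t) 2 (volTime T) :=
    hψ.add (memLp_of_continuousOn hvc.continuousOn)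
  have h1 := h _ hF
  rw [hm.integral_inner_backward hU hT hψ hF, ← hv] at h1
  simp only [real_inner_self_eq_norm_sq] at h1
  rw [integral_eq_zero_iff_of_nonneg (fun t => sq_nonneg _) hF.integrable_norm_pow'] at h1
  have h2 : ∀ᵐ t ∂volTime T, ψ t = -v t := by
    filter_upwards [h1] with t ht
    exact eq_neg_of_add_eq_zero_left (by simpa using ht)
  have h3 : ∀ t ∈ Icc 0 T, duhamel J U T (fun s => m s (-v s)) t = v t := by
    intro t ht
    have hneg : IntegrableOn (fun s => m s (-v s)) (Ioo 0 T) :=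
      hmψ.congr (by filter_upwards [h2] with s hs; rw [hs])
    rw [hv, ← sub_eq_zero, duhamel_sub hU hneg hmψ, ← norm_le_zero_iff]
    refine (WaveTransposition.norm_duhamel_le hU (hneg.sub hmψ) ht).trans (le_of_eq ?_)
    rw [intervalIntegral_eq_integral_Ioo ht.1]
    refine integral_eq_zero_of_ae ?_
    filter_upwards [ae_restrict_of_ae_restrict_of_subset (Ioo_subset_Ioo_right ht.2) h2] with s hs
    simp [hs]
  have h4 : ∀ t ∈ Icc 0 T, ‖-v t‖ ≤ 4 / 3 * 0 * Real.exp (2 * √M * t) := fun t ht =>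
    norm_le_of_volterra (u := fun t => -v t) hvc.neg hM le_rfl (fun s hs => by
      rw [zero_add, norm_neg, ← h3 s hs]
      exact hm.norm_duhamel_le hU hvc.neg hs) ht
  filter_upwards [h2, ae_restrict_mem measurableSet_Ioo] with t ht ht'
  rw [ht, ← norm_le_zero_iff]
  simpa using h4 t (Ioo_subset_Icc_self ht')

end Potential

/-! ### The spaces `H¹_{(0)}(Ω)` and `H^{-1}_{(0)}(Ω)` in terms of `L²(Ω)` -/

theorem H10.dx_surjective : Function.Surjective H10.dx := by
  intro d
  have di : IntegrableOn d (Ioo 0 1) := (Lp.memLp d).integrable one_le_two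
  let v : ℝ → ℝ := fun x => ∫ y in (0 : ℝ)..x, d y
  have hvc : ContinuousOn v (Icc 0 1) := by
    have := intervalIntegral.continuousOn_primitive_interval (μ := volume) (a := 0) (b := 1)
      (f := d) (by
        rw [uIcc_of_le zero_le_one]; exact (integrableOn_Icc_iff_integrableOn_Ioo).mpr di)
    rwa [uIcc_of_le zero_le_one] at this
  have hv : MemLp v 2 volΩ := memLp_of_continuousOn hvc
  have hvd : HasWeakDeriv 0 1 v d :=
    hasWeakDeriv_primitive zero_le_one 0 di fun t _ => by rw [zero_add]
  refine ⟨⟨(hv.toLp v, d), fun η hη => ?_, v, hvc, hv.coeFn_toLp, by simp [v]⟩, rfl⟩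
  rw [← hvd η hη]
  refine integral_congr_ae ?_
  filter_upwards [hv.coeFn_toLp] with s hs
  rw [hs]

/-- `∂ₓ : H¹_{(0)}(Ω) → L²(Ω)` is an isometric isomorphism. -/
def H10.dxEquiv : H10 ≃ₗᵢ[ℝ] L2Ω where
  toLinearEquiv := LinearEquiv.ofBijective H10.dx ⟨H10.dx_injective, H10.dx_surjective⟩
  norm_map' := fun _ => rfl

theorem H10.dxEquiv_apply (z : H10) : H10.dxEquiv z = z.dx := rfl

theorem H10.inclL2_apply (z : H10) : H10.inclL2 z = z.toL2 := rfl

/-- The primitive vanishing at `0`, as an operator on `L²(Ω)`. -/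
def primL : L2Ω →L[ℝ] L2Ω := H10.inclL2.comp (H10.dxEquiv.symm : L2Ω →L[ℝ] H10)

theorem primL_dx (z : H10) : primL z.dx = H10.inclL2 z := by
  change H10.inclL2 (H10.dxEquiv.symm (H10.dxEquiv z)) = _
  rw [LinearIsometryEquiv.symm_apply_apply]

theorem inclL2_dxEquiv_symm (d : L2Ω) : H10.inclL2 (H10.dxEquiv.symm d) = primL d := rfl

theorem norm_primL_le : ‖primL‖ ≤ 1 := by
  refine ContinuousLinearMap.opNorm_le_bound _ zero_le_one fun d => ?_
  rw [one_mul, ← inclL2_dxEquiv_symm, ← H10.dxEquiv.symm.norm_map d]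
  exact H10.norm_toL2_le _

theorem L2Ω.eq_zero_of_forall_test {f : L2Ω}
    (h : ∀ η, IsTestFunction 0 1 η → ∫ s in Ioo (0 : ℝ) 1, η s * f s = 0) : f = 0 := by
  have fi : IntegrableOn f (Ioo 0 1) := (Lp.memLp f).integrable one_le_two
  have key := isOpen_Ioo.ae_eq_zero_of_integral_contDiff_smul_eq_zero
    (U := Ioo (0 : ℝ) 1) (f := f) (μ := volume) fi.locallyIntegrableOn fun ψ hψ hψc hψs => by
      rw [← h ψ ⟨hψ, hψc, hψs⟩]
      refine (setIntegral_eq_integral_of_forall_compl_eq_zero fun x hx => ?_).symm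
      rw [image_eq_zero_of_notMem_tsupport fun h' => hx (hψs h'), zero_smul]
  rw [Lp.eq_zero_iff_ae_eq_zero]
  have : ∀ᵐ x ∂volΩ, f x = 0 := by
    rw [ae_restrict_iff' measurableSet_Ioo]
    exact key
  exact this

theorem injective_primL : Function.Injective primL := by
  rw [injective_iff_map_eq_zero]
  intro d hd
  obtain ⟨z, rfl⟩ := H10.dx_surjective d
  rw [primL_dx, H10.inclL2_apply] at hd
  refine L2Ω.eq_zero_of_forall_test fun η hη => ?_
  have h1 : ∫ s in Ioo (0 : ℝ) 1, deriv η s • z.toL2 s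
      = -∫ s in Ioo (0 : ℝ) 1, η s • z.dx s := z.2.1 η hη
  have h2 : ∫ s in Ioo (0 : ℝ) 1, deriv η s • z.toL2 s = 0 := by
    rw [hd]
    refine integral_eq_zero_of_ae ?_
    filter_upwards [Lp.coeFn_zero ℝ 2 volΩ] with s hs
    rw [hs]
    simp
  rw [h2] at h1
  simpa using h1.symm

theorem L2Ω.inner_eq_integral (f g : L2Ω) : ⟪f, g⟫ = ∫ x, f x * g x ∂volΩ := by
  rw [L2.inner_def]
  refine integral_congr_ae (Eventually.of_forall fun x => ?_)
  simp [mul_comm]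

/-- Every test function is the primitive of its derivative, so it lies in the range of `primL`. An
element of the kernel of `primL†` is orthogonal to that range, hence to all test functions. -/
theorem injective_adjoint_primL : Function.Injective (primL†) := by
  rw [injective_iff_map_eq_zero]
  intro f hf
  refine L2Ω.eq_zero_of_forall_test fun η hη => ?_
  have hd : MemLp (deriv η) 2 volΩ := memLp_of_continuousOn hη.continuous_deriv.continuousOn
  obtain ⟨z, hz⟩ := H10.dx_surjective (hd.toLp _)
  have hzη : ∀ᵐ x ∂volΩ, z.toL2 x = η x := by
    filter_upwards [z.ae_eq_primitive, ae_restrict_mem measurableSet_Ioo] with x hx hx1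
    have h1 : ∫ y in (0 : ℝ)..x, z.dx y = ∫ y in (0 : ℝ)..x, deriv η y := by
      rw [intervalIntegral_eq_integral_Ioo hx1.1.le, intervalIntegral_eq_integral_Ioo hx1.1.le, hz]
      refine integral_congr_ae ?_
      exact ae_restrict_of_ae_restrict_of_subset (Ioo_subset_Ioo_right hx1.2.le) hd.coeFn_toLp
    rw [hx, h1, hη.integral_deriv, hη.apply_left, sub_zero]
  have h2 : ⟪(primL†) f, z.dx⟫ = 0 := by rw [hf, inner_zero_left]
  rw [ContinuousLinearMap.adjoint_inner_left, primL_dx, real_inner_comm,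
    L2Ω.inner_eq_integral] at h2
  refine Eq.trans (integral_congr_ae ?_) h2
  filter_upwards [hzη] with x hx
  rw [H10.inclL2_apply, hx]

/-- The Riesz map `r ↦ ⟪r, ∂ₓ ·⟫` from `L²(Ω)` to `H^{-1}_{(0)}(Ω)`. -/
def rieszL : L2Ω →ₗᵢ[ℝ] Hm1 where
  toFun r := (innerSL ℝ r).comp (H10.dxEquiv : H10 →L[ℝ] L2Ω)
  map_add' r s := by
    ext z
    exact inner_add_left (𝕜 := ℝ) r s z.dx
  map_smul' c r := by
    ext z
    exact real_inner_smul_left r z.dx c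
  norm_map' r := by
    have h := ContinuousLinearMap.opNorm_comp_linearIsometryEquiv (innerSL ℝ r) H10.dxEquiv
    exact h.trans (innerSL_apply_norm (𝕜 := ℝ) r)

theorem rieszL_apply (r : L2Ω) (z : H10) : rieszL r z = ⟪r, z.dx⟫ := rfl

theorem rieszL_surjective : Function.Surjective rieszL := by
  intro φ
  refine ⟨(InnerProductSpace.toDual ℝ L2Ω).symm
    (φ.comp (H10.dxEquiv.symm : L2Ω →L[ℝ] H10)), ?_⟩
  ext z
  rw [rieszL_apply, InnerProductSpace.toDual_symm_apply]
  change φ (H10.dxEquiv.symm (H10.dxEquiv z)) = φ z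
  rw [LinearIsometryEquiv.symm_apply_apply]

/-- Pairing `u` with `z` in `L²(Ω)` is pairing `u` with `primL z.dx`. This identity translates
between the abstract space `H × H` and the concrete dual `Hm1`. -/
theorem toHm1_eq_rieszL (u : L2Ω) : L2Ω.toHm1 u = rieszL ((primL†) u) := by
  ext z
  rw [rieszL_apply, ContinuousLinearMap.adjoint_inner_left, primL_dx]
  rfl

theorem hasWeakDeriv_rieszL_iff {T : ℝ} {u v : ℝ → L2Ω} (hu : IntegrableOn u (Ioo 0 T))
    (hv : IntegrableOn v (Ioo 0 T)) :
    HasWeakDeriv 0 T (fun t => rieszL (u t)) (fun t => rieszL (v t)) ↔ HasWeakDeriv 0 T u v := by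
  refine forall₂_congr fun η hη => ?_
  have h1 : IntegrableOn (fun s => deriv η s • u s) (Ioo 0 T) := by
    obtain ⟨C, hC⟩ := hη.2.1.deriv.exists_bound_of_continuous hη.continuous_deriv
    exact hu.bdd_smul C hη.continuous_deriv.aestronglyMeasurable (Eventually.of_forall hC)
  have h2 : IntegrableOn (fun s => η s • v s) (Ioo 0 T) := by
    obtain ⟨C, hC⟩ := hη.2.1.exists_bound_of_continuous hη.1.continuous
    exact hv.bdd_smul C hη.1.continuous.aestronglyMeasurable (Eventually.of_forall hC)
  have e1 := rieszL.toContinuousLinearMap.integral_comp_comm h1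
  have e2 := rieszL.toContinuousLinearMap.integral_comp_comm h2
  simp only [map_smul, LinearIsometry.coe_toContinuousLinearMap] at e1 e2
  rw [e1, e2, ← map_neg]
  exact rieszL.injective.eq_iff

/-! ### `L²(Q_T)` as `L²(0,T; L²(Ω))` -/

/-- An open set in a second countable space is a countable union of balls, whose preimages are
sublevel sets of distances. For slices these distances are integrals over `Ω`, measurable in `t` by
Tonelli. -/
theorem measurable_of_measurable_dist {α X : Type*} [MeasurableSpace α] [PseudoMetricSpace X]
    [SecondCountableTopology X] [MeasurableSpace X] [BorelSpace X] {f : α → X}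
    (h : ∀ c, Measurable fun t => dist (f t) c) : Measurable f := by
  refine measurable_of_isOpen fun O hO => ?_
  have hr : ∀ x : X, ∃ r, x ∈ O → 0 < r ∧ Metric.ball x r ⊆ O := fun x => by
    by_cases hx : x ∈ O
    · obtain ⟨r, hr, hb⟩ := Metric.isOpen_iff.mp hO x hx
      exact ⟨r, fun _ => ⟨hr, hb⟩⟩
    · exact ⟨0, fun h => absurd h hx⟩
  choose r hr using hr
  obtain ⟨S, hSO, hS, hU⟩ := TopologicalSpace.isOpen_biUnion_countable O
    (fun x => Metric.ball x (r x)) fun _ _ => Metric.isOpen_ball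
  have e : O = ⋃ x ∈ S, Metric.ball x (r x) := by
    rw [hU]
    refine subset_antisymm (fun x hx => ?_) ?_
    · exact mem_iUnion₂.mpr ⟨x, hx, Metric.mem_ball_self (hr x hx).1⟩
    · exact iUnion₂_subset fun x hx => (hr x hx).2
  rw [e, preimage_iUnion₂]
  exact MeasurableSet.biUnion hS fun x _ => measurableSet_lt (h x) measurable_const

open Classical in
/-- The slice `f(·,t)` of a function on `Ω × (0,T)`, as an element of `L²(Ω)`. -/
def sliceFun (f : ℝ × ℝ → ℝ) (t : ℝ) : L2Ω :=
  if h : MemLp (fun x => f (x, t)) 2 volΩ then h.toLp _ else 0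

theorem sliceFun_of_memLp {f : ℝ × ℝ → ℝ} {t : ℝ} (h : MemLp (fun x => f (x, t)) 2 volΩ) :
    sliceFun f t = h.toLp _ := dif_pos h

theorem sliceFun_coeFn {f : ℝ × ℝ → ℝ} {t : ℝ} (h : MemLp (fun x => f (x, t)) 2 volΩ) :
    sliceFun f t =ᵐ[volΩ] fun x => f (x, t) := by
  rw [sliceFun_of_memLp h]
  exact h.coeFn_toLp

instance : SecondCountableTopology L2Ω := by
  have : Fact ((2 : ℝ≥0∞) ≠ ⊤) := ⟨by simp⟩
  infer_instance

theorem measurable_eLpNorm_slice {f : ℝ × ℝ → ℝ} (hf : Measurable f) :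
    Measurable fun t => eLpNorm (fun x => f (x, t)) 2 volΩ := by
  have e : (fun t => eLpNorm (fun x => f (x, t)) 2 volΩ)
      = fun t => (∫⁻ x, ‖f (x, t)‖ₑ ^ (2 : ℝ) ∂volΩ) ^ (1 / 2 : ℝ) := by
    ext1 t
    rw [eLpNorm_eq_lintegral_rpow_enorm_toReal (by simp) (by simp)]
    simp
  rw [e]
  refine Measurable.pow_const ?_ _
  exact Measurable.lintegral_prod_left' (f := fun p : ℝ × ℝ => ‖f p‖ₑ ^ (2 : ℝ))
    (hf.enorm.pow_const _)

theorem stronglyMeasurable_sliceFun {f : ℝ × ℝ → ℝ} (hf : Measurable f) :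
    StronglyMeasurable (sliceFun f) := by
  classical
  borelize L2Ω
  refine Measurable.stronglyMeasurable (measurable_of_measurable_dist fun c => ?_)
  have hsl : ∀ t, AEStronglyMeasurable (fun x => f (x, t)) volΩ := fun t =>
    (hf.comp (measurable_id.prodMk measurable_const)).aestronglyMeasurable
  have hcm : Measurable c := (Lp.stronglyMeasurable c).measurable
  let S : Set ℝ := {t | MemLp (fun x => f (x, t)) 2 volΩ}
  have hS : MeasurableSet S := by
    have : S = {t | eLpNorm (fun x => f (x, t)) 2 volΩ < ⊤} := by
      ext t
      exact ⟨fun h => h.2, fun h => ⟨hsl t, h⟩⟩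
    rw [this]
    exact measurableSet_lt (measurable_eLpNorm_slice hf) measurable_const
  have e : (fun t => dist (sliceFun f t) c) = S.piecewise
      (fun t => (eLpNorm (fun x => f (x, t) - c x) 2 volΩ).toReal) (fun _ => dist 0 c) := by
    ext1 t
    by_cases ht : t ∈ S
    · rw [piecewise_eq_of_mem _ _ _ ht, Lp.dist_def]
      congr 1
      refine eLpNorm_congr_ae ?_
      filter_upwards [sliceFun_coeFn ht] with x hx
      rw [Pi.sub_apply, hx]
    · have ht' : ¬MemLp (fun x => f (x, t)) 2 volΩ := ht
      rw [piecewise_eq_of_notMem _ _ _ ht, sliceFun, dif_neg ht']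
  rw [e]
  refine Measurable.piecewise hS ?_ measurable_const
  exact (measurable_eLpNorm_slice (f := fun p => f p - c p.1)
    (hf.sub (hcm.comp measurable_fst))).ennreal_toReal

variable {T : ℝ}

/-- The slice `F(·,t)` of a function `F ∈ L²(Q_T)`. -/
def slice (F : L2Q T) : ℝ → L2Ω := sliceFun F

theorem ae_volQ {P : ℝ × ℝ → Prop} (h : ∀ᵐ p ∂volQ T, P p) :
    ∀ᵐ t ∂volTime T, ∀ᵐ x ∂volΩ, P (x, t) :=
  Measure.ae_ae_of_ae_prod (Measure.measurePreserving_swap.quasiMeasurePreserving.ae h)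

theorem integrable_mul_L2Q (F G : L2Q T) : Integrable (fun p => F p * G p) (volQ T) :=
  (Lp.memLp F).integrable_mul (Lp.memLp G)

theorem ae_memLp_slice (F : L2Q T) : ∀ᵐ t ∂volTime T, MemLp (fun x => F (x, t)) 2 volΩ := by
  filter_upwards [(integrable_mul_L2Q F F).prod_left_ae] with t ht
  have hm : AEStronglyMeasurable (fun x => F (x, t)) volΩ :=
    ((Lp.stronglyMeasurable F).measurable.comp
      (measurable_id.prodMk measurable_const)).aestronglyMeasurable
  rw [memLp_two_iff_integrable_sq hm]
  simpa only [sq] using ht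

theorem slice_coeFn (F : L2Q T) : ∀ᵐ t ∂volTime T, slice F t =ᵐ[volΩ] fun x => F (x, t) := by
  filter_upwards [ae_memLp_slice F] with t ht
  exact sliceFun_coeFn ht

theorem inner_slice (F G : L2Q T) :
    ∀ᵐ t ∂volTime T, ⟪slice F t, slice G t⟫ = ∫ x, F (x, t) * G (x, t) ∂volΩ := by
  filter_upwards [slice_coeFn F, slice_coeFn G] with t hF hG
  rw [L2Ω.inner_eq_integral]
  refine integral_congr_ae ?_
  filter_upwards [hF, hG] with x h1 h2
  rw [h1, h2]

theorem integral_inner_slice (F G : L2Q T) :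
    ∫ t, ⟪slice F t, slice G t⟫ ∂volTime T = ∫ p, F p * G p ∂volQ T := by
  rw [integral_prod_symm _ (integrable_mul_L2Q F G)]
  exact integral_congr_ae (inner_slice F G)

theorem memLp_slice (F : L2Q T) : MemLp (slice F) 2 (volTime T) := by
  have hm : AEStronglyMeasurable (slice F) (volTime T) :=
    (stronglyMeasurable_sliceFun (Lp.stronglyMeasurable F).measurable).aestronglyMeasurable
  rw [memLp_two_iff_integrable_sq_norm hm]
  refine (integrable_mul_L2Q F F).integral_prod_right.congr ?_
  filter_upwards [inner_slice F F] with t ht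
  rw [← ht, real_inner_self_eq_norm_sq]

theorem slice_add (F G : L2Q T) : ∀ᵐ t ∂volTime T, slice (F + G) t = slice F t + slice G t := by
  filter_upwards [slice_coeFn F, slice_coeFn G, slice_coeFn (F + G),
    ae_volQ (Lp.coeFn_add F G)] with t h1 h2 h3 h4
  refine Lp.ext ?_
  filter_upwards [h1, h2, h3, h4, Lp.coeFn_add (slice F t) (slice G t)] with x k1 k2 k3 k4 k5
  rw [k5, k3, k4, Pi.add_apply, Pi.add_apply, k1, k2]

theorem slice_smul (c : ℝ) (F : L2Q T) : ∀ᵐ t ∂volTime T, slice (c • F) t = c • slice F t := by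
  filter_upwards [slice_coeFn F, slice_coeFn (c • F), ae_volQ (Lp.coeFn_smul c F)]
    with t h1 h2 h3
  refine Lp.ext ?_
  filter_upwards [h1, h2, h3, Lp.coeFn_smul c (slice F t)] with x k1 k2 k3 k4
  rw [k4, k2, k3, Pi.smul_apply, Pi.smul_apply, k1]

theorem inner_toLp_slice (F G : L2Q T) :
    ⟪(memLp_slice F).toLp _, (memLp_slice G).toLp _⟫ = ⟪F, G⟫ := by
  rw [L2.inner_def, L2.inner_def]
  have h1 := integral_inner_slice F G
  refine Eq.trans ?_ (h1.trans ?_)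
  · refine integral_congr_ae ?_
    filter_upwards [(memLp_slice F).coeFn_toLp, (memLp_slice G).coeFn_toLp] with t k1 k2
    rw [k1, k2]
  · refine integral_congr_ae (Eventually.of_forall fun p => ?_)
    simp [mul_comm]

/-- The isometry `L²(Q_T) → L²(0,T; L²(Ω))`. -/
def sliceL (T : ℝ) : L2Q T →ₗᵢ[ℝ] Lp L2Ω 2 (volTime T) where
  toFun F := (memLp_slice F).toLp _
  map_add' F G := by
    rw [← MemLp.toLp_add]
    exact (MemLp.toLp_eq_toLp_iff _ _).mpr (slice_add F G)
  map_smul' c F := by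
    rw [RingHom.id_apply, ← MemLp.toLp_const_smul]
    exact (MemLp.toLp_eq_toLp_iff _ _).mpr (slice_smul c F)
  norm_map' F := by
    have h := inner_toLp_slice F F
    rw [real_inner_self_eq_norm_sq, real_inner_self_eq_norm_sq] at h
    exact (pow_left_inj₀ (norm_nonneg _) (norm_nonneg _) two_ne_zero).mp h

theorem sliceL_coeFn (F : L2Q T) : sliceL T F =ᵐ[volTime T] slice F :=
  (memLp_slice F).coeFn_toLp

/-- Every element of `L²(0,T; L²(Ω))` comes from an element of `L²(Q_T)`. -/
theorem exists_slice_eq {u : ℝ → L2Ω} (hu : MemLp u 2 (volTime T)) :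
    ∃ F : L2Q T, ∀ᵐ t ∂volTime T, slice F t = u t := by
  let σ : L2Q T →L[ℝ] Lp L2Ω 2 (volTime T) := (sliceL T).toContinuousLinearMap
  -- As `σ` is an isometry, `σ F` is the orthogonal projection of `u` on its range. The remainder is
  -- orthogonal to all slices, in particular to `1_s(t) z(x)`, and these already force it to vanish.
  let F : L2Q T := (σ†) (hu.toLp u)
  refine ⟨F, ?_⟩
  have horth : ∀ G : L2Q T, ∫ t, ⟪slice G t, u t - slice F t⟫ ∂volTime T = 0 := by
    intro G
    have h1 : ⟪σ G, hu.toLp u - σ F⟫ = 0 := by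
      rw [inner_sub_right, ← ContinuousLinearMap.adjoint_inner_right]
      have : ⟪σ G, σ F⟫ = ⟪G, F⟫ := inner_toLp_slice G F
      rw [this, sub_self]
    rw [L2.inner_def] at h1
    rw [← h1]
    refine integral_congr_ae ?_
    filter_upwards [sliceL_coeFn G, sliceL_coeFn F, hu.coeFn_toLp,
      Lp.coeFn_sub (hu.toLp u) (σ F)] with t k1 k2 k3 k4
    have k1' : (σ G) t = slice G t := k1
    have k2' : (σ F) t = slice F t := k2
    rw [k4, Pi.sub_apply, k1', k2', k3]
  have hD : MemLp (fun t => u t - slice F t) 2 (volTime T) := hu.sub (memLp_slice F)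
  have hzero : (fun t => u t - slice F t) =ᵐ[volTime T] 0 := by
    refine ae_eq_zero_of_forall_inner (𝕜 := ℝ) fun z => ?_
    refine Integrable.ae_eq_zero_of_forall_setIntegral_eq_zero
      ((hD.integrable one_le_two).const_inner z) fun s hs _ => ?_
    have hg : MemLp (fun p : ℝ × ℝ => s.indicator (1 : ℝ → ℝ) p.2 * z p.1) 2 (volQ T) := by
      have h1 : MemLp (fun p : ℝ × ℝ => z p.1) 2 (volQ T) := (Lp.memLp z).comp_fst _
      refine h1.of_le ?_ (Eventually.of_forall fun p => ?_)
      · exact (((measurable_one.indicator hs).comp measurable_snd).aestronglyMeasurable).mul h1.1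
      · rw [norm_mul]
        refine mul_le_of_le_one_left (norm_nonneg _) ?_
        by_cases hp : p.2 ∈ s <;> simp [hp]
    have h1 := horth (hg.toLp _)
    rw [← integral_indicator hs, ← h1]
    refine integral_congr_ae ?_
    filter_upwards [slice_coeFn (hg.toLp _), ae_volQ hg.coeFn_toLp] with t k1 k2
    have e : slice (hg.toLp _) t = s.indicator (1 : ℝ → ℝ) t • z := by
      refine Lp.ext ?_
      filter_upwards [k1, k2, Lp.coeFn_smul (s.indicator (1 : ℝ → ℝ) t) z] with x l1 l2 l3
      rw [l1, l2, l3]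
      rfl
    rw [e, real_inner_smul_left]
    by_cases ht : t ∈ s <;> simp [ht]
  filter_upwards [hzero] with t ht
  exact (sub_eq_zero.mp ht).symm

/-! ### Multiplication by a bounded potential -/

theorem memLp_mul_of_bdd {a : ℝ → ℝ} (ha : Measurable a) {M : ℝ} (hM : ∀ x, |a x| ≤ M)
    (z : L2Ω) : MemLp (fun x => a x * z x) 2 volΩ :=
  (Lp.memLp z).of_le_mul (ha.aestronglyMeasurable.mul (Lp.memLp z).1)
    (Eventually.of_forall fun x => by
      rw [norm_mul]; exact mul_le_mul_of_nonneg_right (hM x) (norm_nonneg _))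

/-- Multiplication by a bounded measurable function on `L²(Ω)`. -/
def mulL (a : ℝ → ℝ) (ha : Measurable a) (M : ℝ) (hM : ∀ x, |a x| ≤ M) : L2Ω →L[ℝ] L2Ω :=
  LinearMap.mkContinuous
    { toFun := fun z => (memLp_mul_of_bdd ha hM z).toLp _
      map_add' := fun z w => by
        rw [← MemLp.toLp_add, MemLp.toLp_eq_toLp_iff]
        filter_upwards [Lp.coeFn_add z w] with x hx
        rw [hx, Pi.add_apply, Pi.add_apply, mul_add]
      map_smul' := fun c z => by
        rw [RingHom.id_apply, ← MemLp.toLp_const_smul, MemLp.toLp_eq_toLp_iff]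
        filter_upwards [Lp.coeFn_smul c z] with x hx
        rw [hx, Pi.smul_apply, Pi.smul_apply, smul_eq_mul, smul_eq_mul]
        ring } M fun z => by
    refine Lp.norm_le_mul_norm_of_ae_le_mul ?_
    filter_upwards [(memLp_mul_of_bdd ha hM z).coeFn_toLp] with x hx
    change ‖(memLp_mul_of_bdd ha hM z).toLp _ x‖ ≤ _
    rw [hx, norm_mul]
    exact mul_le_mul_of_nonneg_right (hM x) (norm_nonneg _)

theorem mulL_coeFn {a : ℝ → ℝ} (ha : Measurable a) {M : ℝ} (hM : ∀ x, |a x| ≤ M) (z : L2Ω) :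
    mulL a ha M hM z =ᵐ[volΩ] fun x => a x * z x :=
  (memLp_mul_of_bdd ha hM z).coeFn_toLp

theorem norm_mulL_le {a : ℝ → ℝ} (ha : Measurable a) {M : ℝ} (hM : ∀ x, |a x| ≤ M) (z : L2Ω) :
    ‖mulL a ha M hM z‖ ≤ M * ‖z‖ := by
  refine Lp.norm_le_mul_norm_of_ae_le_mul ?_
  filter_upwards [mulL_coeFn ha hM z] with x hx
  rw [hx, norm_mul]
  exact mul_le_mul_of_nonneg_right (hM x) (norm_nonneg _)

/-- The representative of `A ∈ L^∞(Q_T)` truncated at height `‖A‖`. -/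
def clamp (A : LinftyQ T) (p : ℝ × ℝ) : ℝ := max (-‖A‖) (min ‖A‖ (A p))

theorem measurable_clamp (A : LinftyQ T) : Measurable (clamp A) :=
  measurable_const.max (measurable_const.min (Lp.stronglyMeasurable A).measurable)

theorem abs_clamp_le (A : LinftyQ T) (p : ℝ × ℝ) : |clamp A p| ≤ ‖A‖ := by
  rw [abs_le, clamp]
  have := norm_nonneg A
  exact ⟨le_max_left _ _, max_le (by linarith) (min_le_left _ _)⟩

theorem clamp_ae_eq (A : LinftyQ T) : ∀ᵐ p ∂volQ T, clamp A p = A p := by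
  have h : ∀ᵐ p ∂volQ T, ‖A p‖ ≤ ‖A‖ := by
    have h1 := ae_le_eLpNormEssSup (f := A) (μ := volQ T)
    filter_upwards [h1] with p hp
    rw [Lp.norm_def, eLpNorm_exponent_top]
    have hfin : eLpNormEssSup A (volQ T) ≠ ⊤ := by
      have := Lp.eLpNorm_ne_top A
      rwa [eLpNorm_exponent_top] at this
    have := ENNReal.toReal_mono hfin hp
    rwa [toReal_enorm] at this
  filter_upwards [h] with p hp
  rw [Real.norm_eq_abs, abs_le] at hp
  rw [clamp, min_eq_right hp.2, max_eq_right hp.1]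

/-- Multiplication by `A(·,t)` on `L²(Ω)`. -/
def potential (A : LinftyQ T) (t : ℝ) : L2Ω →L[ℝ] L2Ω :=
  mulL (fun x => clamp A (x, t))
    ((measurable_clamp A).comp (measurable_id.prodMk measurable_const)) ‖A‖
    fun _ => abs_clamp_le A _

theorem potential_coeFn (A : LinftyQ T) (t : ℝ) (z : L2Ω) :
    potential A t z =ᵐ[volΩ] fun x => clamp A (x, t) * z x := mulL_coeFn _ _ z

/-- Truncation makes the bound `‖A‖` hold at every point, so each `potential A t` is a bounded
operator without exceptional times. -/
theorem isPotential_potential (A : LinftyQ T) : IsPotential (potential A) ‖A‖ where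
  symm t y z := by
    rw [L2Ω.inner_eq_integral, L2Ω.inner_eq_integral]
    refine integral_congr_ae ?_
    filter_upwards [potential_coeFn A t y, potential_coeFn A t z] with x h1 h2
    rw [h1, h2]
    ring
  norm_le t z := norm_mulL_le _ _ z
  stronglyMeasurable z := by
    have hf : Measurable fun p : ℝ × ℝ => clamp A p * z p.1 :=
      (measurable_clamp A).mul ((Lp.stronglyMeasurable z).measurable.comp measurable_fst)
    convert stronglyMeasurable_sliceFun hf using 1
    ext1 t
    exact (sliceFun_of_memLp (f := fun p : ℝ × ℝ => clamp A p * z p.1) (t := t)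
      (memLp_mul_of_bdd ((measurable_clamp A).comp (measurable_id.prodMk measurable_const))
        (fun _ => abs_clamp_le A _) z)).symm

theorem inner_potential (A : LinftyQ T) :
    ∀ᵐ t ∂volTime T, ∀ y z : L2Ω, ⟪potential A t y, z⟫ = ∫ x, A (x, t) * y x * z x ∂volΩ := by
  filter_upwards [ae_volQ (clamp_ae_eq A)] with t ht y z
  rw [L2Ω.inner_eq_integral]
  refine integral_congr_ae ?_
  filter_upwards [ht, potential_coeFn A t y] with x h1 h2
  rw [h2, h1]

/-! ### Backward weak solutions and mild solutions -/

section Backward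

variable {T : ℝ} {U : ℝ → WithLp 2 (L2Ω × L2Ω) →L[ℝ] WithLp 2 (L2Ω × L2Ω)}

theorem injective_waveOp_primL : Function.Injective (waveOp primL) :=
  injective_waveOp injective_primL injective_adjoint_primL

theorem ae_inner_slice (g : L2Q T) :
    ∀ᵐ t ∂volTime T, ∀ z : L2Ω, ⟪slice g t, z⟫ = ∫ x, g (x, t) * z x ∂volΩ := by
  filter_upwards [slice_coeFn g] with t ht z
  rw [L2Ω.inner_eq_integral]
  refine integral_congr_ae ?_
  filter_upwards [ht] with x hx
  rw [hx]

/-- A weak solution of the backward problem is a mild solution. -/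
theorem IsBackwardWeakSolution.exists_eq_backward (hU : IsUnitaryGroup (waveOp primL) U)
    (hT : 0 < T) {A : LinftyQ T} {g : L2Q T} {w : ℝ → H10} {wt : ℝ → L2Ω}
    (h : IsBackwardWeakSolution T A g w wt) :
    ∃ F : ℝ → L2Ω, MemLp F 2 (volTime T) ∧
      (∀ t ∈ Icc 0 T, wt t = (backward U T F t).fst ∧ -(w t).dx = (backward U T F t).snd) ∧
      ∀ᵐ t ∂volTime T,
        slice g t = F t + potential A t (waveOp primL (backward U T F t)).fst := by
  have hwc : ContinuousOn (fun t => H10.inclL2 (w t)) (Icc 0 T) :=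
    H10.inclL2.continuous.comp_continuousOn h.continuousOn
  have hqc : ContinuousOn (fun t => (w t).dx) (Icc 0 T) :=
    H10.dxEquiv.continuous.comp_continuousOn h.continuousOn
  -- The potential term is moved to the right-hand side, so that `w` solves the free equation with
  -- source `F`.
  let F : ℝ → L2Ω := fun t => slice g t - potential A t (H10.inclL2 (w t))
  have hF : MemLp F 2 (volTime T) :=
    (memLp_slice g).sub ((isPotential_potential A).memLp (memLp_of_continuousOn hwc))
  have hFi : IntegrableOn F (Ioo 0 T) := hF.integrable one_le_two
  have hcI : ∀ {f : ℝ → L2Ω}, ContinuousOn f (Icc 0 T) → IntegrableOn f (Ioo 0 T) := fun hf =>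
    (hf.integrableOn_compact isCompact_Icc).mono_set Ioo_subset_Icc_self
  obtain ⟨wtt, -, hweak, hvar⟩ := h.variational
  have hwtt : ∀ᵐ t ∂volTime T, wtt t = rieszL (-(w t).dx + (primL†) (F t)) := by
    filter_upwards [hvar, ae_inner_slice g, inner_potential A] with t h1 h2 h3
    ext z
    have h1z := h1 z
    rw [← L2Ω.inner_eq_integral, ← h2, ← h3] at h1z
    rw [rieszL_apply, inner_add_left, inner_neg_left, ContinuousLinearMap.adjoint_inner_left,
      primL_dx, inner_sub_left, H10.inclL2_apply, H10.inclL2_apply]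
    linarith
  have hweak' : HasWeakDeriv 0 T (fun t => (primL†) (wt t))
      (fun t => -(w t).dx + (primL†) (F t)) := by
    refine (hasWeakDeriv_rieszL_iff ((primL†).integrable_comp (hcI h.continuousOn_deriv))
      ((hcI hqc.neg).add ((primL†).integrable_comp hFi))).mp ?_
    intro η hη
    simp only [← toHm1_eq_rieszL]
    refine (hweak η hη).trans (congrArg Neg.neg ?_)
    refine integral_congr_ae ?_
    filter_upwards [hwtt] with t ht
    rw [ht]
    rfl
  have hd : ∀ t ∈ Icc 0 T,
      HasDerivWithinAt (fun s => primL (w s).dx) (wt t) (Icc 0 T) t := by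
    simp only [primL_dx]
    exact h.hasDerivWithinAt
  have key : ∀ t ∈ Icc 0 T,
      wt t = (backward U T F t).fst ∧ -(w t).dx = (backward U T F t).snd := fun t ht =>
    eq_backward_of_hasWeakDeriv hU injective_waveOp_primL hT hFi h.continuousOn_deriv hqc hd
      hweak' h.final_deriv (by rw [h.final, map_zero]) ht
  refine ⟨F, hF, key, ?_⟩
  filter_upwards [ae_restrict_mem measurableSet_Ioo] with t ht
  rw [fst_waveOp, ← (key t (Ioo_subset_Icc_self ht)).2, map_neg primL, neg_neg, primL_dx]
  exact (sub_add_cancel _ _).symm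

/-- A mild solution is a weak solution of the backward problem. -/
theorem isBackwardWeakSolution_backward (hU : IsUnitaryGroup (waveOp primL) U)
    (hT : 0 < T) (A : LinftyQ T) {g : L2Q T} {F : ℝ → L2Ω} (hF : MemLp F 2 (volTime T))
    (hg : ∀ᵐ t ∂volTime T,
      slice g t = F t + potential A t (waveOp primL (backward U T F t)).fst) :
    IsBackwardWeakSolution T A g (fun t => H10.dxEquiv.symm (-(backward U T F t).snd))
      (fun t => (backward U T F t).fst) := by
  have hFi : IntegrableOn F (Ioo 0 T) := hF.integrable one_le_two
  have hbc := continuous_backward hU hFi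
  have hfc : Continuous fun s => (backward U T F s).fst :=
    (WithLp.fstL 2 ℝ L2Ω L2Ω).continuous.comp hbc
  have hsc : Continuous fun s => (backward U T F s).snd :=
    (WithLp.sndL 2 ℝ L2Ω L2Ω).continuous.comp hbc
  have hincl : ∀ t, H10.inclL2 (H10.dxEquiv.symm (-(backward U T F t).snd))
      = (waveOp primL (backward U T F t)).fst := fun t => by
    rw [inclL2_dxEquiv_symm, map_neg, fst_waveOp]
  refine ⟨(H10.dxEquiv.symm.continuous.comp hsc.neg).continuousOn, hfc.continuousOn,
    fun t ht => ?_, ⟨fun t => rieszL ((backward U T F t).snd + (primL†) (F t)), ?_, ?_, ?_⟩,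
    ?_, ?_⟩
  · simp only [hincl]
    exact hasDerivWithinAt_fst_waveOp_backward hU hFi ht
  · have h1 : MemLp (fun t => (backward U T F t).snd + (primL†) (F t)) 2 (volTime T) :=
      (memLp_of_continuousOn hsc.continuousOn).add ((primL†).comp_memLp' hF)
    exact rieszL.toContinuousLinearMap.comp_memLp' h1
  · simp only [toHm1_eq_rieszL]
    rw [hasWeakDeriv_rieszL_iff ((primL†).integrable_comp
      ((hfc.continuousOn.integrableOn_compact isCompact_Icc).mono_set Ioo_subset_Icc_self))
      (integrableOn_backward_rhs hU hFi)]
    exact hasWeakDeriv_adjoint_fst_backward hU hT.le hFi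
  · filter_upwards [hg, ae_inner_slice g, inner_potential A] with t h1 h2 h3 z
    rw [← L2Ω.inner_eq_integral, ← h2, ← h3, h1, rieszL_apply, ← H10.inclL2_apply,
      ← H10.inclL2_apply, hincl, inner_add_left, inner_add_left,
      ContinuousLinearMap.adjoint_inner_left, primL_dx, ← H10.dxEquiv_apply (H10.dxEquiv.symm _),
      LinearIsometryEquiv.apply_symm_apply, inner_neg_left]
    ring
  · rw [backward_final hU hFi]
    change H10.dxEquiv.symm (-0) = 0
    rw [neg_zero, map_zero]
  · rw [backward_final hU hFi]
    rfl

theorem integral_integral_zero_mul (w : ℝ → H10) :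
    ∫ t, ∫ x, (0 : L2Q T) (x, t) * (w t).toL2 x ∂volΩ ∂volTime T = 0 := by
  refine integral_eq_zero_of_ae ?_
  filter_upwards [ae_volQ (Lp.coeFn_zero ℝ 2 (volQ T))] with t ht
  refine integral_eq_zero_of_ae ?_
  filter_upwards [ht] with x hx
  rw [hx]
  simp

end Backward

/-! ### Existence, uniqueness and bounds -/

/-- The mild form of `w` turns `∫ φ g` into `-⟪(φ₀, r₀), (wt 0, -(w 0).dx)⟫`, whose two terms are
exactly the two boundary terms at `t = 0`. -/
theorem isTranspositionSolution_of_slice_eq {T : ℝ} (hT : 0 < T)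
    {U : ℝ → WithLp 2 (L2Ω × L2Ω) →L[ℝ] WithLp 2 (L2Ω × L2Ω)}
    (hU : IsUnitaryGroup (waveOp primL) U) {A : LinftyQ T} {φ₀ r₀ : L2Ω} {u : ℝ → L2Ω}
    (huc : Continuous u)
    (hu : ∀ t ∈ Icc 0 T, u t = (U t (WithLp.toLp 2 (φ₀, r₀))).fst
      - duhamel primL U T (fun s => potential A s (u s)) t)
    {φ : L2Q T} (hφ : ∀ᵐ t ∂volTime T, slice φ t = u t) :
    IsTranspositionSolution T A 0 φ₀ (rieszL r₀) φ := by
  intro g w wt hw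
  obtain ⟨F, hF, hFw, hgF⟩ := hw.exists_eq_backward hU hT
  have h1 := (isPotential_potential A).integral_inner_solution hU hT.le huc hu hF
  have h2 : ∫ p, φ p * g p ∂volQ T
      = ∫ t in Ioo 0 T, ⟪u t, F t + potential A t (waveOp primL (backward U T F t)).fst⟫ := by
    rw [← integral_inner_slice]
    refine integral_congr_ae ?_
    filter_upwards [hφ, hgF] with t k1 k2
    rw [k1, k2]
  obtain ⟨h3, h4⟩ := hFw 0 (left_mem_Icc.mpr hT.le)
  rw [h2, h1, integral_integral_zero_mul, zero_add, rieszL_apply, ← L2Ω.inner_eq_integral,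
    WithLp.prod_inner_apply]
  change -(⟪φ₀, (backward U T F 0).fst⟫ + ⟪r₀, (backward U T F 0).snd⟫) = _
  rw [← h3, ← h4, inner_neg_right]
  ring

theorem IsTranspositionSolution.unique {T : ℝ} (hT : 0 < T)
    {U : ℝ → WithLp 2 (L2Ω × L2Ω) →L[ℝ] WithLp 2 (L2Ω × L2Ω)}
    (hU : IsUnitaryGroup (waveOp primL) U) {A : LinftyQ T} {B : L2Q T} {φ₀ : L2Ω} {φ₁ : Hm1}
    {φ ψ : L2Q T} (hψ : IsTranspositionSolution T A B φ₀ φ₁ ψ)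
    (hφ : IsTranspositionSolution T A B φ₀ φ₁ φ) : ψ = φ := by
  have hm := isPotential_potential A
  have key : ∀ᵐ t ∂volTime T, slice (ψ - φ) t = 0 := by
    refine hm.ae_eq_zero_of_forall_integral_inner (norm_nonneg A) hU hT.le
      (memLp_slice (ψ - φ)) fun F hF => ?_
    -- Given `F`, the right-hand side is chosen as `g = F + A w`, with `w` the free backward
    -- solution for `F`; then `w` solves the backward problem with potential for this `g`.
    obtain ⟨g, hg⟩ := exists_slice_eq
      (hF.add (hm.memLp (memLp_fst_waveOp_backward hU (hF.integrable one_le_two))))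
    have hw := isBackwardWeakSolution_backward hU hT A hF hg
    have h1 := (hψ g _ _ hw).trans (hφ g _ _ hw).symm
    have h2 : ∫ p, (ψ - φ) p * g p ∂volQ T = 0 := by
      rw [← sub_eq_zero, ← integral_sub (integrable_mul_L2Q ψ g) (integrable_mul_L2Q φ g)] at h1
      refine Eq.trans (integral_congr_ae ?_) h1
      filter_upwards [Lp.coeFn_sub ψ φ] with p hp
      rw [hp, Pi.sub_apply, sub_mul]
    rw [← integral_inner_slice] at h2
    refine Eq.trans (integral_congr_ae ?_) h2
    filter_upwards [hg] with t ht
    rw [ht]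
    rfl
  have hz : sliceL T (ψ - φ) = 0 := by
    rw [Lp.eq_zero_iff_ae_eq_zero]
    filter_upwards [sliceL_coeFn (ψ - φ), key] with t h1 h2
    rw [h1, h2]
    rfl
  exact sub_eq_zero.mp ((sliceL T).injective (hz.trans (map_zero _).symm))

/-- The factor `M` from the bound on `∂ₜφ` is absorbed by `M ≤ 2 exp (√M)`. The exponent needed is
`(1 + 2 T) √M` and the prefactor `7/3 + 8/3 T`; both fit under `3 + 3 T`. -/
theorem bound_arith {T M a : ℝ} (hT : 0 < T) (hM : 0 ≤ M) (ha : 0 ≤ a) :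
    4 / 3 * a * Real.exp (2 * √M * T) + (a + M * (4 / 3 * a * Real.exp (2 * √M * T)) * T)
      ≤ (3 + 3 * T) * Real.exp ((3 + 3 * T) * √M) * a := by
  have hs : 0 ≤ √M := Real.sqrt_nonneg M
  have h1 : M ≤ 2 * Real.exp (√M) := by
    have h := Real.quadratic_le_exp_of_nonneg hs
    rw [Real.sq_sqrt hM] at h
    linarith
  have h2 : Real.exp (√M) * Real.exp (2 * √M * T) ≤ Real.exp ((3 + 3 * T) * √M) := by
    rw [← Real.exp_add]
    refine Real.exp_le_exp.mpr ?_
    have := mul_nonneg hs hT.le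
    nlinarith
  have h3 : Real.exp (2 * √M * T) ≤ Real.exp ((3 + 3 * T) * √M) := by
    refine Real.exp_le_exp.mpr ?_
    have := mul_nonneg hs hT.le
    nlinarith
  have h4 : 1 ≤ Real.exp ((3 + 3 * T) * √M) := Real.one_le_exp (by positivity)
  have h5 : M * Real.exp (2 * √M * T) ≤ 2 * Real.exp ((3 + 3 * T) * √M) := by
    calc _ ≤ 2 * Real.exp (√M) * Real.exp (2 * √M * T) := by gcongr
      _ = 2 * (Real.exp (√M) * Real.exp (2 * √M * T)) := by ring
      _ ≤ _ := by gcongr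
  set Z := Real.exp ((3 + 3 * T) * √M) with hZ
  calc _ = (4 / 3 * Real.exp (2 * √M * T) + 1 + 4 / 3 * T * (M * Real.exp (2 * √M * T))) * a := by
        ring
    _ ≤ (4 / 3 * Z + Z + 4 / 3 * T * (2 * Z)) * a := by gcongr
    _ ≤ (3 + 3 * T) * Z * a := by
        refine mul_le_mul_of_nonneg_right ?_ ha
        have : 0 ≤ T * Z := by positivity
        nlinarith

end WaveTransposition

end

open WaveTransposition in
theorem theorem5 (T : ℝ) (hT : 0 < T) :
    ∃ C : ℝ, 0 < C ∧ ∀ (A : LinftyQ T) (φ₀ : L2Ω) (φ₁ : Hm1),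
      ∃ φ : L2Q T, IsTranspositionSolution T A 0 φ₀ φ₁ φ ∧
        (∀ ψ : L2Q T, IsTranspositionSolution T A 0 φ₀ φ₁ ψ → ψ = φ) ∧
        ∃ (u : ℝ → L2Ω) (ut : ℝ → Hm1), IsContinuousRepresentative T φ u ut ∧
          ∀ t ∈ Set.Icc (0 : ℝ) T,
            ‖u t‖ + ‖ut t‖
              ≤ C * Real.exp (C * Real.sqrt ‖A‖) * Real.sqrt (‖φ₀‖ ^ 2 + ‖φ₁‖ ^ 2) := by
  refine ⟨3 + 3 * T, by positivity, fun A φ₀ φ₁ => ?_⟩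
  obtain ⟨U, hU⟩ := (isSkew_waveOp primL).exists_unitaryGroup injective_waveOp_primL
  -- In Riesz coordinates the data form a vector `X = (φ₀, r₀)` whose Hilbert norm is the norm of
  -- `L² × H⁻¹` in the statement.
  obtain ⟨r₀, rfl⟩ := rieszL_surjective φ₁
  have hm := isPotential_potential A
  obtain ⟨u, huc, hu, hub⟩ :=
    hm.exists_solution (norm_nonneg A) hU hT.le (WithLp.toLp 2 (φ₀, r₀))
  have hX : ‖WithLp.toLp 2 (φ₀, r₀)‖ = Real.sqrt (‖φ₀‖ ^ 2 + ‖rieszL r₀‖ ^ 2) := by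
    rw [WithLp.prod_norm_eq_of_L2, rieszL.norm_map]
    rfl
  set X := WithLp.toLp 2 (φ₀, r₀) with hXdef
  obtain ⟨φ, hφ⟩ := exists_slice_eq (memLp_of_continuousOn (T := T) huc.continuousOn)
  have hsol := isTranspositionSolution_of_slice_eq hT hU huc hu hφ
  have hG : IntegrableOn (fun s => potential A s (u s)) (Set.Ioo 0 T) :=
    (hm.memLp (memLp_of_continuousOn huc.continuousOn)).integrable one_le_two
  refine ⟨φ, hsol, fun ψ hψ => hψ.unique hT hU hsol, u,
    fun t => rieszL (duhamelDeriv primL U T X (fun s => potential A s (u s)) t),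
    ⟨?_, huc.continuousOn, ?_, fun t ht => ?_⟩, fun t ht => ?_⟩
  · filter_upwards [hφ, slice_coeFn φ] with t h1 h2
    rw [h1] at h2
    filter_upwards [h2] with x hx
    exact hx.symm
  · exact (rieszL.continuous.comp (continuous_duhamelDeriv hU hG X)).continuousOn
  · have h1 := hasDerivWithinAt_adjoint_duhamel hU hG X ht
    have h2 := rieszL.toContinuousLinearMap.hasFDerivAt.comp_hasDerivWithinAt t h1
    refine h2.congr_of_mem (fun s hs => ?_) ht
    rw [toHm1_eq_rieszL]
    nth_rewrite 1 [hu s hs]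
    rfl
  · have hexp : ∀ s ∈ Set.Icc (0 : ℝ) T,
        ‖u s‖ ≤ 4 / 3 * ‖X‖ * Real.exp (2 * √‖A‖ * T) := fun s hs => by
      refine (hub s hs).trans ?_
      gcongr
      exact hs.2
    -- The potential term `A u` is bounded on `[0,T]` by `‖A‖` times the bound already obtained for
    -- `u`; its contribution to `∂ₜφ` costs a further factor `T`.
    have h1 := norm_duhamelDeriv_le hU norm_primL_le X (G := fun s => potential A s (u s))
      (b := ‖A‖ * (4 / 3 * ‖X‖ * Real.exp (2 * √‖A‖ * T)))
      (fun s hs => (hm.norm_le s (u s)).trans (by gcongr; exact hexp s hs)) ht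
    rw [rieszL.norm_map, ← hX]
    exact (add_le_add (hexp t ht) h1).trans (bound_arith hT (norm_nonneg A) (norm_nonneg X))
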